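/- **Predicates.** Let $\Pi^+$ be the absolutely free algebra generated by countably many propositional variables, with a constant $1'$, binary operations $+$, $;$ and unary operations $\overline{\phantom{A}}$ (complement) and $\smile$ (converse); its elements are called predicates. Put $A\vee B=A+B$, $A\wedge B=\overline{\overline A+\overline B}$, ${\sim}A=\overline{A^{\smile}}$, $A\to B=\overline{A^{\smile};\overline B}$, $A\circ B=B;A$, $\mathbf t=1'$, and let $A\le B$ be the equation $A+B=B$. Let $\Pi^r\subseteq\Pi^+$ be the set of predicates built from $\mathbf t$ and the propositional variables by $\vee,\wedge,{\sim},\to,\circ$. **Logics.** For $n\ge 3$ and a set $\Psi$ of equations between predicates, $\mathsf{CT}_n^{\Psi}$ is the set of predicates $A$ such that $1'\le A$ is provable from $\Psi$ in the standard $n$-variable first-order formalism with predicate operators: formulas use only the variables $\mathsf v_0,\dots,\mathsf v_{n-1}$ and are built by $\Rightarrow,\neg,\forall$ from the atomic formulas $xAy$ and equations $A=B$ $(A,B\in\Pi^+)$; the axioms are Tarski's closed axiom schemes for first-order logic with equality $1'$ and the general Leibniz law $x1'y\Rightarrow(\varphi\Rightarrow\varphi[x/y])$, and the defining axioms of $+,\overline{\phantom{A}},;,\smile$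 and of equations; the only rule is modus ponens (associativity of $;$ is not an axiom). Let $\mathsf{CT}_3=\mathsf{CT}_3^{\emptyset}$ and let $\mathsf{TR}=\mathsf{CT}_4^{\Psi}$, where $\Psi$ consists of all equations $A\le A;A$ (density) and $A;B=B;A$ (commutativity). A predicate $A$ is *$3$-provable from density and symmetry* if the sequent $\mid \mathsf v_0A\mathsf v_0$ is derivable in Maddux's sequent calculus restricted to three variables from the sequents $xAy,\Gamma\mid xBy,\Delta$ and $xBy,\Gamma\mid xAy,\Delta$, where $A=B$ is an equation of density or of symmetry ($C=C^{\smile}$). **Frames.** A frame $(K,R,{}^*,I)$ is a set $K$ with $R\subseteq K^3$, ${}^*:K\to K$ and $I\subseteq K$. Its complex algebra is the power set of $K$ with $X+Y=X\cup Y$, $\overline X=K\setminus X$, $X;Y=\{z: Rxyz\text{ for some }x\in X,y\in Y\}$, $X^{\smile}=\{x^*:x\in X\}$ and $1'=I$. A predicate $A$ is valid in the frame if $I\subseteq h(A)$ for every homomorphism $h$ from $\Pi^+$ to the complex algebra. A $\mathsf{CR}$-frame is a frame with $I=\{0\}$ such that $R0ab\Leftrightarrow a=b$; $\exists x(Rabx\wedge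 Rxcd)\Leftrightarrow\exists y(Racy\wedge Rybd)$; $Raaa$; $a^{**}=a$; $Rabc\Leftrightarrow Rac^*b^*$. The relevance logic $\mathsf R$ is the set of those $A\in\Pi^r$ which, as formulas in $\vee,\wedge,{\sim},\to,\circ,\mathbf t$, are true at $0$ in every $\mathsf{CR}$-frame under every assignment of subsets of $K$ to the propositional variables, with the usual truth conditions: $\vee,\wedge$ are pointwise; $\mathbf t$ holds exactly at $0$; $a\models{\sim}A$ iff $a^*\not\models A$; $a\models A\to B$ iff for all $b,c$, $Rabc$ and $b\models A$ imply $c\models B$; $a\models A\circ B$ iff $Rbca$, $b\models A$, $c\models B$ for some $b,c$. **Theorem.** Consider the eleven predicates 1. $(A\to B)\to((C\to A)\to(C\to B))$ 2. $(A\to(B\to C))\to(A\circ B\to C)$ 3. $(A\circ B\to C)\to(A\to(B\to C))$ 4. $(A\to B)\to(A\circ C\to B\circ C)$ 5. $(A\circ B)\circ C\to A\circ(B\circ C)$ 6. $A\circ(B\circ C)\to(A\circ B)\circ C$ 7. $(A\to(B\to C))\to(B\to(A\to C))$ 8. $(A\to B)\to((B\to C)\to(A\to C))$ 9. $(A\to(A\to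 B))\to(A\to B)$ 10. $(A\to(B\to C))\to(A\wedge B\to C)$ 11. $(A\to(B\to C))\to((A\to B)\to(A\to C))$ Each of them is in $\mathsf R$ for all $A,B,C\in\Pi^r$, and in $\mathsf{TR}$ for all $A,B,C\in\Pi^+$. If $A,B,C$ are distinct propositional variables, then none of them is in $\mathsf{CT}_3$, none of them is $3$-provable from density and symmetry, and none of them is valid in the following frame $\mathfrak K_1$. The frame $\mathfrak K_1$ has $K=\{0,a,b,c\}$, $I=\{0\}$, $x^*=x$, and $Rxyz$ iff $z\in x;y$, where $0;x=x;0=\{x\}$, $x;x=\{0,x\}$ for $x\ne0$, and $x;y=\{z\}$ whenever $\{x,y,z\}=\{a,b,c\}$. Its complex algebra is a dense symmetric semi-associative relation algebra (it satisfies Tarski's relation algebra axioms with associativity weakened to $X;(Y;1)=(X;Y);1$, it satisfies $X\subseteq X;X$, and $X^{\smile}=X$) in which $;$ is not associative. -/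

import Mathlib

namespace RelLogic

/-! ### Predicates -/

/-- The set `Π⁺` of predicates: the absolutely free algebra generated by countably many
propositional variables, with the constant `1'` (`one`), union `+`, complement, relative
product `;` (`comp`) and converse. The atomic predicates are `one` and the `var i`. -/
inductive Predicate : Type where
  | one : Predicate
  | var : ℕ → Predicate
  | add : Predicate → Predicate → Predicate
  | compl : Predicate → Predicate
  | comp : Predicate → Predicate → Predicate
  | conv : Predicate → Predicate

namespace Predicate

/-- `A · B`, intersection. -/
def inf (A B : Predicate) : Predicate := compl (add (compl A) (compl B))

/-- Disjunction `A ∨ B`. -/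
def or (A B : Predicate) : Predicate := add A B

/-- Conjunction `A ∧ B`. -/
def and (A B : Predicate) : Predicate := inf A B

/-- De Morgan negation `∼A`. -/
def dneg (A : Predicate) : Predicate := compl (conv A)

/-- Implication `A → B`. -/
def imp (A B : Predicate) : Predicate := compl (comp (conv A) (compl B))

/-- Fusion `A ∘ B`. -/
def fus (A B : Predicate) : Predicate := comp B A

/-- Truth `t`. -/
def tt : Predicate := one

end Predicate

/-- An equation between predicates, written as a pair. -/
abbrev Equation : Type := Predicate × Predicate

/-- The inclusion `A ≤ B`, i.e. the equation `A + B = B`. -/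
def incl (A B : Predicate) : Equation := (Predicate.add A B, B)

/-- The equations of density `A ≤ A ; A`. -/
def densityEqs : Set Equation := {e | ∃ A : Predicate, e = incl A (Predicate.comp A A)}

/-- The equations of commutativity `A ; B = B ; A`. -/
def commEqs : Set Equation := {e | ∃ A B : Predicate, e = (Predicate.comp A B, Predicate.comp B A)}

/-- The equations of symmetry `A = A˘`. -/
def symmEqs : Set Equation := {e | ∃ A : Predicate, e = (A, Predicate.conv A)}

/-! ### First-order formulas with predicate operators, and the `n`-variable Hilbert systems -/

/-- Formulas; the variable `v_i` is represented by the number `i`. -/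
inductive Formula : Type where
  /-- `x A y` -/
  | rel : ℕ → Predicate → ℕ → Formula
  /-- `A = B`, a formula without free variables -/
  | eqn : Predicate → Predicate → Formula
  | imp : Formula → Formula → Formula
  | neg : Formula → Formula
  | all : ℕ → Formula → Formula

namespace Formula

def or (φ ψ : Formula) : Formula := imp (neg φ) ψ

def and (φ ψ : Formula) : Formula := neg (imp φ (neg ψ))

def iff (φ ψ : Formula) : Formula := neg (imp (imp φ ψ) (neg (imp ψ φ)))

def ex (x : ℕ) (φ : Formula) : Formula := neg (all x (neg φ))

/-- The free variables. -/
def fv : Formula → Finset ℕ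
  | rel x _ y => {x, y}
  | eqn _ _ => ∅
  | imp φ ψ => fv φ ∪ fv ψ
  | neg φ => fv φ
  | all x φ => (fv φ).erase x

/-- Only the variables `v_0, …, v_{n-1}` occur (free or bound). -/
def UsesOnly (n : ℕ) : Formula → Prop
  | rel x _ y => x < n ∧ y < n
  | eqn _ _ => True
  | imp φ ψ => UsesOnly n φ ∧ UsesOnly n ψ
  | neg φ => UsesOnly n φ
  | all x φ => x < n ∧ UsesOnly n φ

/-- The universal closure; the quantifier on the last free variable is innermost. -/
def closure (φ : Formula) : Formula := ((fv φ).sort (· ≤ ·)).foldr all φ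

/-- The first variable outside a finite set. -/
def fresh (S : Finset ℕ) : ℕ := Nat.find (Infinite.exists_notMem_finset S)

/-- Simultaneous capture-avoiding substitution of `f x` for the free occurrences of `x`. A bound
variable is renamed only to avoid capture, and then to the first admissible variable. Hence a
formula in `n` variables stays in these `n` variables if `f` maps them to themselves. -/
def subst : Formula → (ℕ → ℕ) → Formula
  | rel x A y, f => rel (f x) A (f y)
  | eqn A B, _ => eqn A B
  | imp φ ψ, f => imp (subst φ f) (subst ψ f)
  | neg φ, f => neg (subst φ f)
  | all x φ, f =>
      let S : Finset ℕ := ((fv φ).erase x).image f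
      let w : ℕ := if x ∈ S then fresh S else x
      all w (subst φ (Function.update f x w))

/-- `φ[x/y]`. -/
def replace (φ : Formula) (x y : ℕ) : Formula := subst φ (Function.update id x y)

end Formula

open Formula in
/-- The logical postulates (of any number of variables): Tarski's schemes for first-order logic with
equality `1'`, in closed form, with the general Leibniz law, followed by the definitions of
the predicate operators. -/
inductive Postulate : Formula → Prop where
  | a1 (φ ψ ξ : Formula) :
      Postulate (closure (imp (imp φ ψ) (imp (imp ψ ξ) (imp φ ξ))))
  | a2 (φ : Formula) : Postulate (closure (imp (imp (neg φ) φ) φ))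
  | a3 (φ ψ : Formula) : Postulate (closure (imp φ (imp (neg φ) ψ)))
  | a4 (x y : ℕ) (φ : Formula) :
      Postulate (closure (imp (all x (all y φ)) (all y (all x φ))))
  | a5 (x : ℕ) (φ ψ : Formula) :
      Postulate (closure (imp (all x (imp φ ψ)) (imp (all x φ) (all x ψ))))
  | a6 (x : ℕ) (φ : Formula) : Postulate (closure (imp (all x φ) φ))
  | a7 (x : ℕ) (φ : Formula) (hx : x ∉ fv φ) : Postulate (closure (imp φ (all x φ)))
  | a8 (x y : ℕ) (hxy : x ≠ y) : Postulate (closure (ex x (rel x Predicate.one y)))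
  | a9 (x y : ℕ) (φ : Formula) :
      Postulate (closure (imp (rel x Predicate.one y) (imp φ (replace φ x y))))
  | d1 (A B : Predicate) :
      Postulate (closure (iff (rel 0 (Predicate.add A B) 1) (or (rel 0 A 1) (rel 0 B 1))))
  | d2 (A : Predicate) : Postulate (closure (iff (rel 0 (Predicate.compl A) 1) (neg (rel 0 A 1))))
  | d3 (A B : Predicate) :
      Postulate (closure
        (iff (rel 0 (Predicate.comp A B) 1) (ex 2 (and (rel 0 A 2) (rel 2 B 1)))))
  | d4 (A : Predicate) : Postulate (closure (iff (rel 0 (Predicate.conv A) 1) (rel 1 A 0)))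
  | d5 (A B : Predicate) :
      Postulate (iff (eqn A B) (closure (iff (rel 0 A 1) (rel 0 B 1))))

/-- Provability from the set of equations `Ψ` in the standard `n`-variable formalism (`n ≥ 3`): the
postulates are the instances written with the first `n` variables only, and modus ponens is the
only rule. The associative law of `;` is not among the postulates. -/
inductive Proves (n : ℕ) (Ψ : Set Equation) : Formula → Prop where
  | post (φ : Formula) (h : Postulate φ) (hn : φ.UsesOnly n) : Proves n Ψ φ
  | hyp (e : Equation) (he : e ∈ Ψ) : Proves n Ψ (Formula.eqn e.1 e.2)
  | mp (φ ψ : Formula) (h₁ : Proves n Ψ (Formula.imp φ ψ)) (h₂ : Proves n Ψ φ) : Proves n Ψ ψ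

/-- The logic `CT_n^Ψ`: the predicates `A` for which `1' ≤ A` is provable from `Ψ` with `n`
variables. -/
def CT (n : ℕ) (Ψ : Set Equation) : Set Predicate :=
  {A | Proves n Ψ (Formula.eqn (incl Predicate.one A).1 (incl Predicate.one A).2)}

/-- Tarski's classical relevant logic. -/
def TR : Set Predicate := CT 4 (densityEqs ∪ commEqs)

/-! ### The `n`-variable sequent calculus -/

/-- The expression `x A y`, as it occurs in sequents. -/
structure Fm : Type where
  src : ℕ
  pred : Predicate
  tgt : ℕ

/-- All variables that occur in members of `Γ` are among the first `n`. -/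
def InVars (n : ℕ) (Γ : Set Fm) : Prop := ∀ a ∈ Γ, a.src < n ∧ a.tgt < n

/-- The variable `y` occurs in no member of `Γ`. -/
def Avoids (y : ℕ) (Γ : Set Fm) : Prop := ∀ a ∈ Γ, a.src ≠ y ∧ a.tgt ≠ y

/-- `SeqProves n Ψ Γ Δ`: the sequent `Γ | Δ` is `n`-provable from the set `Ψ` of `n`-sequents. -/
inductive SeqProves (n : ℕ) (Ψ : Set (Set Fm × Set Fm)) : Set Fm → Set Fm → Prop where
  | hyp (Γ Δ : Set Fm) (h : (Γ, Δ) ∈ Ψ) : SeqProves n Ψ Γ Δ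
  | start (Γ Δ : Set Fm) (hΓ : InVars n Γ) (hΔ : InVars n Δ) (h : (Γ ∩ Δ).Nonempty) :
      SeqProves n Ψ Γ Δ
  | one_right (Γ Δ : Set Fm) (x : ℕ) (hΓ : InVars n Γ) (hΔ : InVars n Δ) (hx : x < n) :
      SeqProves n Ψ Γ (Δ ∪ {⟨x, Predicate.one, x⟩})
  | cut (Γ Γ' Δ Δ' : Set Fm) (a : Fm) (h₁ : SeqProves n Ψ Γ (Δ ∪ {a}))
      (h₂ : SeqProves n Ψ ({a} ∪ Γ') Δ') : SeqProves n Ψ (Γ ∪ Γ') (Δ ∪ Δ')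
  | one_left (Γ Δ : Set Fm) (x y z : ℕ) (A : Predicate) (hz : z < n)
      (h : SeqProves n Ψ ({⟨x, A, y⟩} ∪ Γ) Δ) :
      SeqProves n Ψ ({⟨x, A, z⟩, ⟨z, Predicate.one, y⟩} ∪ Γ) Δ
  | add_left (Γ Γ' Δ Δ' : Set Fm) (x y : ℕ) (A B : Predicate)
      (h₁ : SeqProves n Ψ ({⟨x, A, y⟩} ∪ Γ) Δ) (h₂ : SeqProves n Ψ ({⟨x, B, y⟩} ∪ Γ') Δ') :
      SeqProves n Ψ ({⟨x, Predicate.add A B, y⟩} ∪ Γ ∪ Γ') (Δ ∪ Δ')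
  | add_right (Γ Δ : Set Fm) (x y : ℕ) (A B : Predicate)
      (h : SeqProves n Ψ Γ (Δ ∪ {⟨x, A, y⟩, ⟨x, B, y⟩})) :
      SeqProves n Ψ Γ (Δ ∪ {⟨x, Predicate.add A B, y⟩})
  | inf_left (Γ Δ : Set Fm) (x y : ℕ) (A B : Predicate)
      (h : SeqProves n Ψ (Γ ∪ {⟨x, A, y⟩, ⟨x, B, y⟩}) Δ) :
      SeqProves n Ψ (Γ ∪ {⟨x, Predicate.inf A B, y⟩}) Δ
  | inf_right (Γ Γ' Δ Δ' : Set Fm) (x y : ℕ) (A B : Predicate)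
      (h₁ : SeqProves n Ψ Γ (Δ ∪ {⟨x, A, y⟩})) (h₂ : SeqProves n Ψ Γ' (Δ' ∪ {⟨x, B, y⟩})) :
      SeqProves n Ψ (Γ ∪ Γ') (Δ ∪ Δ' ∪ {⟨x, Predicate.inf A B, y⟩})
  | compl_left (Γ Δ : Set Fm) (x y : ℕ) (A : Predicate)
      (h : SeqProves n Ψ Γ (Δ ∪ {⟨x, A, y⟩})) :
      SeqProves n Ψ ({⟨x, Predicate.compl A, y⟩} ∪ Γ) Δ
  | compl_right (Γ Δ : Set Fm) (x y : ℕ) (A : Predicate)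
      (h : SeqProves n Ψ ({⟨x, A, y⟩} ∪ Γ) Δ) :
      SeqProves n Ψ Γ (Δ ∪ {⟨x, Predicate.compl A, y⟩})
  | comp_left (Γ Δ : Set Fm) (x y z : ℕ) (A B : Predicate)
      (hyx : y ≠ x) (hyz : y ≠ z) (hΓ : Avoids y Γ) (hΔ : Avoids y Δ)
      (h : SeqProves n Ψ ({⟨x, A, y⟩, ⟨y, B, z⟩} ∪ Γ) Δ) :
      SeqProves n Ψ ({⟨x, Predicate.comp A B, z⟩} ∪ Γ) Δ
  | comp_right (Γ Γ' Δ Δ' : Set Fm) (x y z : ℕ) (A B : Predicate)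
      (h₁ : SeqProves n Ψ Γ (Δ ∪ {⟨x, A, y⟩})) (h₂ : SeqProves n Ψ Γ' (Δ' ∪ {⟨y, B, z⟩})) :
      SeqProves n Ψ (Γ ∪ Γ') (Δ ∪ Δ' ∪ {⟨x, Predicate.comp A B, z⟩})
  | conv_left (Γ Δ : Set Fm) (x y : ℕ) (A : Predicate)
      (h : SeqProves n Ψ ({⟨x, A, y⟩} ∪ Γ) Δ) :
      SeqProves n Ψ ({⟨y, Predicate.conv A, x⟩} ∪ Γ) Δ
  | conv_right (Γ Δ : Set Fm) (x y : ℕ) (A : Predicate)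
      (h : SeqProves n Ψ Γ (Δ ∪ {⟨x, A, y⟩})) :
      SeqProves n Ψ Γ (Δ ∪ {⟨y, Predicate.conv A, x⟩})

/-- The `n`-sequents corresponding to a set of equations: all `x A y, Γ | x B y, Δ` and
`x B y, Γ | x A y, Δ` with `A = B` in `Ψ`. -/
def corrSequents (n : ℕ) (Ψ : Set Equation) : Set (Set Fm × Set Fm) :=
  {s | ∃ (A B : Predicate) (x y : ℕ) (Γ Δ : Set Fm), ((A, B) ∈ Ψ ∨ (B, A) ∈ Ψ) ∧
    x < n ∧ y < n ∧ InVars n Γ ∧ InVars n Δ ∧ s = ({⟨x, A, y⟩} ∪ Γ, {⟨x, B, y⟩} ∪ Δ)}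

/-- The predicate `A` is `n`-provable from the equations in `Ψ`: the sequent `| v_0 A v_0` is
`n`-provable from the sequents corresponding to `Ψ`. -/
def NProvable (n : ℕ) (Ψ : Set Equation) (A : Predicate) : Prop :=
  SeqProves n (corrSequents n Ψ) ∅ {⟨0, A, 0⟩}

/-! ### Algebras, frames and complex algebras -/

/-- An algebra of the similarity type of the predicate algebra. -/
structure Alg (U : Type*) where
  add : U → U → U
  compl : U → U
  comp : U → U → U
  conv : U → U
  one : U

namespace Alg

variable {U : Type*} (𝔄 : Alg U)

/-- The Boolean unit `1 = 1' + (complement of 1')`. -/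
def top : U := 𝔄.add 𝔄.one (𝔄.compl 𝔄.one)

def le (x y : U) : Prop := 𝔄.add x y = y

def Dense : Prop := ∀ x, 𝔄.le x (𝔄.comp x x)

def Symmetric : Prop := ∀ x, 𝔄.conv x = x

def Associative : Prop := ∀ x y z, 𝔄.comp x (𝔄.comp y z) = 𝔄.comp (𝔄.comp x y) z

/-- Semi-associative relation algebras. -/
structure IsSemiassociative : Prop where
  r1 : ∀ x y, 𝔄.add x y = 𝔄.add y x
  r2 : ∀ x y z, 𝔄.add x (𝔄.add y z) = 𝔄.add (𝔄.add x y) z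
  r3 : ∀ x y, 𝔄.add (𝔄.compl (𝔄.add (𝔄.compl x) (𝔄.compl y)))
    (𝔄.compl (𝔄.add (𝔄.compl x) y)) = x
  r4s : ∀ x y, 𝔄.comp x (𝔄.comp y 𝔄.top) = 𝔄.comp (𝔄.comp x y) 𝔄.top
  r5 : ∀ x y z, 𝔄.comp (𝔄.add x y) z = 𝔄.add (𝔄.comp x z) (𝔄.comp y z)
  r6 : ∀ x, 𝔄.comp x 𝔄.one = x
  r7 : ∀ x, 𝔄.conv (𝔄.conv x) = x
  r8 : ∀ x y, 𝔄.conv (𝔄.add x y) = 𝔄.add (𝔄.conv x) (𝔄.conv y)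
  r9 : ∀ x y, 𝔄.conv (𝔄.comp x y) = 𝔄.comp (𝔄.conv y) (𝔄.conv x)
  r10 : ∀ x y, 𝔄.add (𝔄.comp (𝔄.conv x) (𝔄.compl (𝔄.comp x y))) (𝔄.compl y) = 𝔄.compl y

/-- `h` is a homomorphism from the predicate algebra to `𝔄`. -/
structure IsHom (h : Predicate → U) : Prop where
  map_one : h Predicate.one = 𝔄.one
  map_add : ∀ A B, h (Predicate.add A B) = 𝔄.add (h A) (h B)
  map_compl : ∀ A, h (Predicate.compl A) = 𝔄.compl (h A)
  map_comp : ∀ A B, h (Predicate.comp A B) = 𝔄.comp (h A) (h B)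
  map_conv : ∀ A, h (Predicate.conv A) = 𝔄.conv (h A)

end Alg

/-- A frame on the set `K`. -/
structure Frame (K : Type*) where
  R : K → K → K → Prop
  star : K → K
  I : Set K

namespace Frame

variable {K : Type*} (F : Frame K)

/-- The complex algebra. -/
def Cm : Alg (Set K) where
  add X Y := X ∪ Y
  compl X := Xᶜ
  comp X Y := {z | ∃ x ∈ X, ∃ y ∈ Y, F.R x y z}
  conv X := F.star '' X
  one := F.I

/-- Validity of a predicate in a frame. -/
def Valid (A : Predicate) : Prop := ∀ h : Predicate → Set K, F.Cm.IsHom h → F.I ⊆ h A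

/-- `CR`-frames (Meyer and Routley). -/
def IsCRFrame : Prop :=
  ∃ o : K, F.I = {o} ∧
    (∀ a b, F.R o a b ↔ a = b) ∧
    (∀ a b c d, (∃ x, F.R a b x ∧ F.R x c d) ↔ ∃ y, F.R a c y ∧ F.R y b d) ∧
    (∀ a, F.R a a a) ∧
    (∀ a, F.star (F.star a) = a) ∧
    (∀ a b c, F.R a b c ↔ F.R a (F.star c) (F.star b))

end Frame

/-! ### The relevance logic `R` -/

/-- Formulas of the relevance logic `R`. -/
inductive RFormula : Type where
  | var : ℕ → RFormula
  | tt : RFormula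
  | or : RFormula → RFormula → RFormula
  | and : RFormula → RFormula → RFormula
  | dneg : RFormula → RFormula
  | imp : RFormula → RFormula → RFormula
  | fus : RFormula → RFormula → RFormula

namespace RFormula

/-- The predicate denoted by a formula of `R`. -/
def toPred : RFormula → Predicate
  | var i => Predicate.var i
  | tt => Predicate.tt
  | or φ ψ => Predicate.or (toPred φ) (toPred ψ)
  | and φ ψ => Predicate.and (toPred φ) (toPred ψ)
  | dneg φ => Predicate.dneg (toPred φ)
  | imp φ ψ => Predicate.imp (toPred φ) (toPred ψ)
  | fus φ ψ => Predicate.fus (toPred φ) (toPred ψ)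

/-- Distinct formulas denote distinct predicates, so that formulas of `R` can be identified with
the predicates built by the relevance logic operators. -/
theorem toPred_injective : Function.Injective toPred := by
  intro φ
  induction φ <;> intro ψ h <;> cases ψ <;>
    simp only [toPred, Predicate.tt, Predicate.or, Predicate.and, Predicate.inf, Predicate.dneg,
      Predicate.imp, Predicate.fus, Predicate.add.injEq, Predicate.compl.injEq,
      Predicate.comp.injEq, Predicate.conv.injEq, Predicate.var.injEq, reduceCtorEq] at h <;>
    grind

/-- Truth at a point of a frame under a valuation (Meyer and Routley). -/
def Holds {K : Type*} (F : Frame K) (v : ℕ → Set K) : RFormula → K → Prop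
  | var i, a => a ∈ v i
  | tt, a => a ∈ F.I
  | or φ ψ, a => Holds F v φ a ∨ Holds F v ψ a
  | and φ ψ, a => Holds F v φ a ∧ Holds F v ψ a
  | dneg φ, a => ¬ Holds F v φ (F.star a)
  | imp φ ψ, a => ∀ b c, F.R a b c → Holds F v φ b → Holds F v ψ c
  | fus φ ψ, a => ∃ b c, F.R b c a ∧ Holds F v φ b ∧ Holds F v ψ c

/-- Validity in every `CR`-frame: truth at every point of `I` under every valuation. -/
def CRValid (φ : RFormula) : Prop :=
  ∀ (K : Type) (F : Frame K), F.IsCRFrame → ∀ v : ℕ → Set K, ∀ a ∈ F.I, Holds F v φ a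

end RFormula

/-- `Π^r`: the predicates built from atomic predicates by the relevance logic operators. -/
def relevancePreds : Set Predicate := Set.range RFormula.toPred

/-- The relevance logic `R`, as a set of predicates. -/
def logicR : Set Predicate := {P | ∃ φ : RFormula, φ.toPred = P ∧ φ.CRValid}

/-! ### The frame `K₁` and the eleven predicates -/

/-- The table of `{x} ; {y}`; the elements `0, a, b, c` are `0, 1, 2, 3`. -/
def K₁table : Fin 4 → Fin 4 → Finset (Fin 4) :=
  ![![{0}, {1}, {2}, {3}],
    ![{1}, {0, 1}, {3}, {2}],
    ![{2}, {3}, {0, 2}, {1}],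
    ![{3}, {2}, {1}, {0, 3}]]

def K₁ : Frame (Fin 4) where
  R x y z := z ∈ K₁table x y
  star x := x
  I := {0}

/-- Names of the eleven schemes. -/
inductive Scheme : Type where
  | prefixing | imp_to_fus | fus_to_imp | fus_mono | fus_assoc | fus_assoc_rev
  | permutation | suffixing | contraction | contraction_and | self_distribution

open Predicate in
/-- The predicates that are instances of the schemes. -/
def Scheme.inst : Scheme → Predicate → Predicate → Predicate → Predicate
  | prefixing, A, B, C => imp (imp A B) (imp (imp C A) (imp C B))
  | imp_to_fus, A, B, C => imp (imp A (imp B C)) (imp (fus A B) C)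
  | fus_to_imp, A, B, C => imp (imp (fus A B) C) (imp A (imp B C))
  | fus_mono, A, B, C => imp (imp A B) (imp (fus A C) (fus B C))
  | fus_assoc, A, B, C => imp (fus (fus A B) C) (fus A (fus B C))
  | fus_assoc_rev, A, B, C => imp (fus A (fus B C)) (fus (fus A B) C)
  | permutation, A, B, C => imp (imp A (imp B C)) (imp B (imp A C))
  | suffixing, A, B, C => imp (imp A B) (imp (imp B C) (imp A C))
  | contraction, A, B, _ => imp (imp A (imp A B)) (imp A B)
  | contraction_and, A, B, C => imp (imp A (imp B C)) (imp (and A B) C)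
  | self_distribution, A, B, C => imp (imp A (imp B C)) (imp (imp A B) (imp A C))

end RelLogic

namespace RelLogic

/-! ### The complex algebra of `K₁` -/

/-! For the negative claims, an algebra in which `;` is not associative has no representation by
binary relations, so ordinary assignments are unavailable over `K₁`. They are replaced by 3×3
matrices of atoms in which every triangle is permitted: the entry at `i, j` is the atom relating the
variables `i` and `j`, and quantifying over `x` means changing the row and column of `x`. Three
indices carry a single proper triangle, so one row can be changed with almost no constraint
(`exists_eqOff_agreeOn`). Hence quantifiers commute, and substitution, including the renaming of
bound variables, becomes reindexing (`truth_subst`), which yields the general Leibniz law. Both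
three-variable calculi are therefore sound for `K₁`, where density and symmetry hold outright, and
singletons of atoms refute every scheme.

For `R`, the law `R0ab ↔ a = b` and the Pasch postulate make `R` commutative and allow triples to be
reassociated. Each scheme then amounts to rearranging two or three triples, with `Raaa` supplying a
second copy of a point where a hypothesis is used twice.

For `TR`, residuation (`below_imp_of_comp`, `comp_below_of_below_imp`) and associativity of `;`,
obtained with the fourth variable, reduce every scheme to a short chain of inequalities using
commutativity and density. Since the formalism has only closed axioms and modus ponens, reasoning
with open formulas must first be justified (`lifts_and_detaches`). Completeness of Łukasiewicz's
axioms (`exists_valuation`) then identifies provability with truth in all Boolean valuations that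
contain the theorems, and derivations are carried out inside such worlds. -/

theorem K₁_comm : ∀ x y z, K₁.R x y z → K₁.R y x z := by
  unfold K₁; decide

theorem K₁_cycle : ∀ x y z, K₁.R x y z → K₁.R x z y := by
  unfold K₁; decide

theorem K₁_exists_right : ∀ x z, ∃ y, K₁.R x y z := by
  unfold K₁; decide

theorem K₁_exists_comp : ∀ x y, ∃ z, K₁.R x y z := by
  unfold K₁; decide

theorem K₁_zero : ∀ x y, K₁.R x 0 y ↔ x = y := by
  unfold K₁; decide

theorem K₁_self : ∀ x, K₁.R x x x := by
  unfold K₁; decide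

theorem K₁_conv (X : Set (Fin 4)) : K₁.Cm.conv X = X := Set.image_id X

theorem K₁_comp_comm (X Y : Set (Fin 4)) : K₁.Cm.comp X Y = K₁.Cm.comp Y X := by
  ext z
  constructor <;> rintro ⟨x, hx, y, hy, h⟩ <;> exact ⟨y, hy, x, hx, K₁_comm _ _ _ h⟩

theorem K₁_top : K₁.Cm.top = Set.univ := Set.union_compl_self _

/-- Any two atoms lie in a common triangle, so a product with the unit is empty or everything.
Semi-associativity thereby reduces to a question of nonemptiness. -/
theorem K₁_comp_univ (X : Set (Fin 4)) (z : Fin 4) :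
    z ∈ K₁.Cm.comp X Set.univ ↔ X.Nonempty := by
  constructor
  · rintro ⟨x, hx, -⟩
    exact ⟨x, hx⟩
  · rintro ⟨x, hx⟩
    obtain ⟨y, h⟩ := K₁_exists_right x z
    exact ⟨x, hx, y, trivial, h⟩

theorem K₁_isSemiassociative : K₁.Cm.IsSemiassociative where
  r1 := Set.union_comm
  r2 x y z := (Set.union_assoc x y z).symm
  r3 x y := by
    change (xᶜ ∪ yᶜ)ᶜ ∪ (xᶜ ∪ y)ᶜ = x
    ext z
    simp only [Set.compl_union, compl_compl, Set.mem_union, Set.mem_inter_iff, Set.mem_compl_iff]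
    tauto
  r4s x y := by
    ext z
    rw [K₁_top, K₁_comp_univ]
    constructor
    · rintro ⟨p, hp, q, hq, -⟩
      obtain ⟨r, hr⟩ := (K₁_comp_univ y q).1 hq
      obtain ⟨t, ht⟩ := K₁_exists_comp p r
      exact ⟨t, p, hp, r, hr, ht⟩
    · rintro ⟨t, p, hp, r, hr, -⟩
      obtain ⟨q, hq⟩ := K₁_exists_right p z
      exact ⟨p, hp, q, (K₁_comp_univ y q).2 ⟨r, hr⟩, hq⟩
  r5 x y z := by
    ext t
    constructor
    · rintro ⟨p, hp | hp, q, hq, h⟩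
      · exact Or.inl ⟨p, hp, q, hq, h⟩
      · exact Or.inr ⟨p, hp, q, hq, h⟩
    · rintro (⟨p, hp, q, hq, h⟩ | ⟨p, hp, q, hq, h⟩)
      · exact ⟨p, Or.inl hp, q, hq, h⟩
      · exact ⟨p, Or.inr hp, q, hq, h⟩
  r6 x := by
    ext t
    constructor
    · rintro ⟨p, hp, q, rfl, h⟩
      exact (K₁_zero p t).1 h ▸ hp
    · intro ht
      exact ⟨t, ht, 0, rfl, (K₁_zero t t).2 rfl⟩
  r7 x := by simp only [K₁_conv]
  r8 x y := by simp only [K₁_conv]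
  r9 x y := by simpa only [K₁_conv] using K₁_comp_comm x y
  r10 x y := by
    rw [K₁_conv]
    apply Set.union_eq_self_of_subset_left
    rintro t ⟨p, hp, q, hq, h⟩ ht
    -- Exchanging the last two places of the triangle puts `q` into the product of which it was
    -- assumed to lie outside.
    exact hq ⟨p, hp, t, ht, K₁_cycle _ _ _ h⟩

theorem K₁_dense : K₁.Cm.Dense := fun _ =>
  Set.union_eq_self_of_subset_left fun t ht => ⟨t, ht, t, ht, K₁_self t⟩

/-- Since `a;a` contains both `0` and `a`, the set `(a;a);b` is `{b, c}`, whereas `a;(a;b) = a;c =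
{b}`. -/
theorem K₁_not_associative : ¬ K₁.Cm.Associative := by
  intro h
  have h1 : (3 : Fin 4) ∈ K₁.Cm.comp (K₁.Cm.comp {1} {1}) {2} :=
    ⟨1, ⟨1, rfl, 1, rfl, by unfold K₁; decide⟩, 2, rfl, by unfold K₁; decide⟩
  rw [← h] at h1
  obtain ⟨x, rfl, y, ⟨x, rfl, z, rfl, h2⟩, h3⟩ := h1
  revert h2 h3
  unfold K₁
  revert y
  decide

/-- The extension of a valuation to all predicates in the complex algebra of `K₁`, by finite
sets. -/
def K₁eval (v : ℕ → Finset (Fin 4)) : Predicate → Finset (Fin 4)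
  | .one => {0}
  | .var i => v i
  | .add A B => K₁eval v A ∪ K₁eval v B
  | .compl A => (K₁eval v A)ᶜ
  | .comp A B => Finset.univ.filter fun z =>
      ∃ x ∈ K₁eval v A, ∃ y ∈ K₁eval v B, z ∈ K₁table x y
  | .conv A => K₁eval v A

theorem K₁eval_isHom (v : ℕ → Finset (Fin 4)) :
    K₁.Cm.IsHom fun A => (K₁eval v A : Set (Fin 4)) where
  map_one := by simp [K₁eval, Frame.Cm, K₁]
  map_add A B := by simp [K₁eval, Frame.Cm]
  map_compl A := by simp [K₁eval, Frame.Cm]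
  map_comp A B := by ext z; simp [K₁eval, Frame.Cm, K₁]
  map_conv A := by simp only [K₁eval, K₁_conv]

/-- Singletons refuting the schemes in `K₁`. -/
def Scheme.witness : Scheme → Fin 4 × Fin 4 × Fin 4
  | .prefixing => (1, 2, 2)
  | .imp_to_fus => (1, 1, 2)
  | .fus_to_imp => (1, 2, 2)
  | .fus_mono => (1, 2, 1)
  | .fus_assoc => (1, 1, 2)
  | .fus_assoc_rev => (1, 2, 2)
  | .permutation => (1, 2, 1)
  | .suffixing => (1, 2, 1)
  | .contraction => (1, 2, 0)
  | .contraction_and => (1, 1, 2)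
  | .self_distribution => (1, 1, 2)

theorem K₁_not_valid (s : Scheme) (i j k : ℕ) (hij : i ≠ j) (hik : i ≠ k) (hjk : j ≠ k) :
    ¬ K₁.Valid (s.inst (.var i) (.var j) (.var k)) := by
  intro h
  let v : ℕ → Finset (Fin 4) := fun n =>
    if n = i then {s.witness.1} else if n = j then {s.witness.2.1} else {s.witness.2.2}
  have hi : v i = {s.witness.1} := if_pos rfl
  have hj : v j = {s.witness.2.1} := by simp [v, hij.symm]
  have hk : v k = {s.witness.2.2} := by simp [v, hik.symm, hjk.symm]
  -- Evaluation in finite sets turns refutation into a decidable computation.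
  have h0 : (0 : Fin 4) ∈ K₁eval v (s.inst (.var i) (.var j) (.var k)) :=
    Finset.mem_coe.1 (h _ (K₁eval_isHom v) rfl)
  revert h0
  cases s <;>
    simp only [Scheme.inst, Predicate.imp, Predicate.fus, Predicate.and, Predicate.inf, K₁eval,
      hi, hj, hk, Scheme.witness] <;>
    decide +kernel

end RelLogic

namespace RelLogic

/-! ### The relevance logic `R` -/

/-- The schemes, as formulas of `R`. -/
def Scheme.rinst : Scheme → RFormula → RFormula → RFormula → RFormula
  | prefixing, A, B, C => .imp (.imp A B) (.imp (.imp C A) (.imp C B))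
  | imp_to_fus, A, B, C => .imp (.imp A (.imp B C)) (.imp (.fus A B) C)
  | fus_to_imp, A, B, C => .imp (.imp (.fus A B) C) (.imp A (.imp B C))
  | fus_mono, A, B, C => .imp (.imp A B) (.imp (.fus A C) (.fus B C))
  | fus_assoc, A, B, C => .imp (.fus (.fus A B) C) (.fus A (.fus B C))
  | fus_assoc_rev, A, B, C => .imp (.fus A (.fus B C)) (.fus (.fus A B) C)
  | permutation, A, B, C => .imp (.imp A (.imp B C)) (.imp B (.imp A C))
  | suffixing, A, B, C => .imp (.imp A B) (.imp (.imp B C) (.imp A C))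
  | contraction, A, B, _ => .imp (.imp A (.imp A B)) (.imp A B)
  | contraction_and, A, B, C => .imp (.imp A (.imp B C)) (.imp (.and A B) C)
  | self_distribution, A, B, C => .imp (.imp A (.imp B C)) (.imp (.imp A B) (.imp A C))

theorem Scheme.toPred_rinst (s : Scheme) (φ ψ χ : RFormula) :
    (s.rinst φ ψ χ).toPred = s.inst φ.toPred ψ.toPred χ.toPred := by
  cases s <;> rfl

/-- Identity at `0` and the Pasch postulate give commutativity of `R`, and commutativity turns Pasch
into both directions of associativity. Each scheme is then a rearrangement of the given triples. -/
theorem Scheme.rinst_crValid (s : Scheme) (φ ψ χ : RFormula) : (s.rinst φ ψ χ).CRValid := by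
  rintro K F ⟨o, hI, hid, hpasch, hdense, -, -⟩ v a ha
  have hao : a = o := by simpa [hI] using ha
  subst hao
  have comm {a b c} (h : F.R a b c) : F.R b a c := by
    obtain ⟨y, hy, h'⟩ := (hpasch _ a b c).1 ⟨a, (hid _ _).2 rfl, h⟩
    rwa [(hid _ _).1 hy]
  have pasch {a b x c d} (h : F.R a b x) (h' : F.R x c d) : ∃ y, F.R a c y ∧ F.R y b d :=
    (hpasch a b c d).1 ⟨x, h, h'⟩
  have assoc {a b x c d} (h : F.R a b x) (h' : F.R x c d) : ∃ y, F.R b c y ∧ F.R a y d := by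
    obtain ⟨y, hy, hy'⟩ := pasch (comm h) h'
    exact ⟨y, hy, comm hy'⟩
  have assoc' {a b x c d} (h : F.R a b x) (h' : F.R c x d) : ∃ y, F.R c a y ∧ F.R y b d := by
    obtain ⟨y, hy, hy'⟩ := pasch h (comm h')
    exact ⟨y, comm hy, hy'⟩
  -- Because `R0bc` forces `b = c`, an implication at `0` is an inclusion between antecedent and
  -- consequent, checked at a single point.
  cases s <;> intro b _ hb hyp <;> obtain rfl := (hid _ _).1 hb
  case prefixing =>
    intro c d h1 hc e f h2 he
    obtain ⟨y, hy, hy'⟩ := assoc h1 h2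
    exact hyp _ _ hy' (hc _ _ hy he)
  case imp_to_fus =>
    rintro c d h1 ⟨e, f, h2, he, hf⟩
    obtain ⟨y, hy, hy'⟩ := assoc' h2 h1
    exact hyp _ _ hy he _ _ hy' hf
  case fus_to_imp =>
    intro c d h1 hc e f h2 he
    obtain ⟨y, hy, hy'⟩ := assoc h1 h2
    exact hyp _ _ hy' ⟨_, _, hy, hc, he⟩
  case fus_mono =>
    rintro c d h1 ⟨e, f, h2, he, hf⟩
    obtain ⟨y, hy, hy'⟩ := assoc' h2 h1
    exact ⟨_, _, hy', hyp _ _ hy he, hf⟩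
  case fus_assoc =>
    obtain ⟨c, d, h1, ⟨e, f, h2, he, hf⟩, hd⟩ := hyp
    obtain ⟨y, hy, hy'⟩ := assoc h2 h1
    exact ⟨_, _, hy', he, _, _, hy, hf, hd⟩
  case fus_assoc_rev =>
    obtain ⟨c, d, h1, hc, e, f, h2, he, hf⟩ := hyp
    obtain ⟨y, hy, hy'⟩ := assoc' h2 h1
    exact ⟨_, _, hy', ⟨_, _, hy, hc, he⟩, hf⟩
  case permutation =>
    intro c d h1 hc e f h2 he
    obtain ⟨y, hy, hy'⟩ := pasch h1 h2
    exact hyp _ _ hy he _ _ hy' hc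
  case suffixing =>
    intro c d h1 hc e f h2 he
    obtain ⟨y, hy, hy'⟩ := pasch h1 h2
    exact hc _ _ (comm hy') (hyp _ _ hy he)
  case contraction =>
    intro c d h1 hc
    obtain ⟨y, hy, hy'⟩ := assoc' (hdense c) h1
    exact hyp _ _ hy hc _ _ hy' hc
  case contraction_and =>
    rintro c d h1 ⟨hc, hc'⟩
    obtain ⟨y, hy, hy'⟩ := assoc' (hdense c) h1
    exact hyp _ _ hy hc _ _ hy' hc'
  case self_distribution =>
    intro c d h1 hc e f h2 he
    -- The point `e` is needed twice, once for each implication with antecedent `A`; `Reee`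
    -- duplicates it.
    obtain ⟨y, hy, hy'⟩ := assoc' (hdense e) h2
    obtain ⟨z, hz, hz'⟩ := pasch h1 hy
    obtain ⟨t, ht, ht'⟩ := assoc hz' hy'
    exact hyp _ _ hz he _ _ ht' (hc _ _ ht he)

theorem Scheme.inst_mem_logicR (s : Scheme) {A B C : Predicate} (hA : A ∈ relevancePreds)
    (hB : B ∈ relevancePreds) (hC : C ∈ relevancePreds) : s.inst A B C ∈ logicR := by
  obtain ⟨φ, rfl⟩ := hA
  obtain ⟨ψ, rfl⟩ := hB
  obtain ⟨χ, rfl⟩ := hC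
  exact ⟨s.rinst φ ψ χ, s.toPred_rinst φ ψ χ, s.rinst_crValid φ ψ χ⟩

end RelLogic

namespace RelLogic

/-! ### Three-dimensional basic matrices over `K₁` -/

/-- The basic matrices of dimension `3` over the atoms of the complex algebra of `K₁`. -/
structure BasicMatrix where
  entry : Fin 3 → Fin 3 → Fin 4
  diag : ∀ i, entry i i = 0
  triangle : ∀ i j k, K₁.R (entry i j) (entry j k) (entry i k)

namespace BasicMatrix

theorem entry_symm (m : BasicMatrix) (i j : Fin 3) : m.entry i j = m.entry j i := by
  have key : ∀ x y, K₁.R x y 0 → x = y := by unfold K₁; decide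
  exact key _ _ (m.diag i ▸ m.triangle i j i)

/-- Reindexing a matrix along a map of the index set. -/
def comp (m : BasicMatrix) (e : Fin 3 → Fin 3) : BasicMatrix where
  entry i j := m.entry (e i) (e j)
  diag _ := m.diag _
  triangle _ _ _ := m.triangle _ _ _

/-- The two matrices agree outside the row and the column of `x`. -/
def EqOff (x : Fin 3) (m m' : BasicMatrix) : Prop :=
  ∀ i j, i ≠ x → j ≠ x → m.entry i j = m'.entry i j

/-- The two matrices agree on the index set `D`. -/
def AgreeOn (D : Set (Fin 3)) (m m' : BasicMatrix) : Prop :=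
  ∀ i ∈ D, ∀ j ∈ D, m.entry i j = m'.entry i j

theorem AgreeOn.eq {D : Set (Fin 3)} {m m' : BasicMatrix} (h : AgreeOn D m m')
    (hD : ∀ i, i ∈ D) : m = m' := by
  cases m
  cases m'
  congr
  exact funext fun i => funext fun j => h i (hD i) j (hD j)

theorem EqOff.refl (x : Fin 3) (m : BasicMatrix) : EqOff x m m := fun _ _ _ _ => rfl

theorem EqOff.symm {x : Fin 3} {m m' : BasicMatrix} (h : EqOff x m m') : EqOff x m' m :=
  fun i j hi hj => (h i j hi hj).symm

theorem EqOff.trans {x : Fin 3} {m m' m'' : BasicMatrix} (h : EqOff x m m')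
    (h' : EqOff x m' m'') : EqOff x m m'' :=
  fun i j hi hj => (h i j hi hj).trans (h' i j hi hj)

/-- `K₁.R` is invariant under all permutations of its three places, so one permitted triangle makes
every triangle of the symmetric matrix permitted. The matrix is built on `0, 1, 2` and reindexed. -/
theorem exists_of_triangle {i j k : Fin 3} (hij : i ≠ j) (hik : i ≠ k) (hjk : j ≠ k)
    {p q r : Fin 4} (h : K₁.R p q r) :
    ∃ m : BasicMatrix, m.entry i j = p ∧ m.entry j k = q ∧ m.entry i k = r := by
  have key : ∀ p q r, K₁.R p q r → ∀ i j k,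
      K₁.R (![![0, p, r], ![p, 0, q], ![r, q, 0]] i j)
        (![![0, p, r], ![p, 0, q], ![r, q, 0]] j k)
        (![![0, p, r], ![p, 0, q], ![r, q, 0]] i k) := by
    unfold K₁
    decide +kernel
  let m : BasicMatrix :=
    ⟨![![0, p, r], ![p, 0, q], ![r, q, 0]], by intro i; fin_cases i <;> rfl, key p q r h⟩
  refine ⟨m.comp fun a => if a = i then 0 else if a = j then 1 else 2, ?_⟩
  simp [comp, hij.symm, hik.symm, hjk.symm, m]

theorem exists_others : ∀ x : Fin 3, ∃ y z, x ≠ y ∧ x ≠ z ∧ y ≠ z ∧ ∀ i, i = x ∨ i = y ∨ i = z := by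
  decide

/-- A matrix can be changed in one row and column so as to agree with another one on `D`, if they
agree on the rest of `D`. -/
theorem exists_eqOff_agreeOn (m m₁ : BasicMatrix) (x : Fin 3) (D : Set (Fin 3))
    (h : AgreeOn (D \ {x}) m m₁) : ∃ m', EqOff x m m' ∧ AgreeOn (insert x D) m₁ m' := by
  -- If `z` is outside `D`, the edge `zy` comes from `m` and `yx` from `m₁`; the edge `zx` is free
  -- and is chosen to close the triangle.
  have aux : ∀ y z, x ≠ y → x ≠ z → y ≠ z → (∀ i, i = x ∨ i = y ∨ i = z) → z ∉ D →
      ∃ m', EqOff x m m' ∧ AgreeOn (insert x D) m₁ m' := by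
    intro y z hxy hxz hyz hall hz
    obtain ⟨t, ht⟩ := K₁_exists_comp (m.entry z y) (m₁.entry y x)
    obtain ⟨m', h1, h2, -⟩ := exists_of_triangle hyz.symm hxz.symm hxy.symm ht
    have h1' := h1
    have h2' := h2
    rw [entry_symm, entry_symm m] at h1'
    rw [entry_symm, entry_symm m₁] at h2'
    refine ⟨m', fun i j hi hj => ?_, fun i hi j hj => ?_⟩
    · rcases hall i with rfl | rfl | rfl <;> rcases hall j with rfl | rfl | rfl <;>
        simp_all [diag]
    · have hi' : i ≠ z := by rintro rfl; simp_all
      have hj' : j ≠ z := by rintro rfl; simp_all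
      rcases hall i with rfl | rfl | rfl <;> rcases hall j with rfl | rfl | rfl <;>
        simp_all [diag]
  obtain ⟨y, z, hxy, hxz, hyz, hall⟩ := exists_others x
  by_cases hz : z ∈ D
  · by_cases hy : y ∈ D
    -- With both other indices in `D`, the two matrices already agree off `x`, so `m₁` itself
    -- serves.
    · refine ⟨m₁, fun i j hi hj => h i ⟨?_, hi⟩ j ⟨?_, hj⟩, fun _ _ _ _ => rfl⟩
      · rcases hall i with rfl | rfl | rfl <;> simp_all
      · rcases hall j with rfl | rfl | rfl <;> simp_all
    · exact aux z y hxz hxy hyz.symm (fun i => by have := hall i; tauto) hy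
  · exact aux y z hxy hxz hyz hall hz

/-- After `x` and `y` are both freed, only one diagonal entry is constrained, and it is always `0`.
Two different quantifiers therefore range over all matrices, in either order. -/
theorem exists_eqOff_eqOff (m m' : BasicMatrix) {x y : Fin 3} (hxy : x ≠ y) :
    ∃ m₁, EqOff x m m₁ ∧ EqOff y m₁ m' := by
  obtain ⟨m₁, h1, h2⟩ := exists_eqOff_agreeOn m m' x ({y}ᶜ) (by
    intro i hi j hj
    obtain rfl : i = j := by
      revert hi hj hxy
      revert i j x y
      simp only [Set.mem_sdiff, Set.mem_compl_iff, Set.mem_singleton_iff]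
      decide
    rw [diag, diag])
  exact ⟨m₁, h1, fun i j hi hj => (h2 i (Or.inr hi) j (Or.inr hj)).symm⟩

/-- One half of the quantifier case of substitution: `F` is the substitution, `X` the bound
variable, `W` its new name and `D` the free variables of the body. As `W` is not hit by the other
members of `D`, a change at `W` is visible only at `X` after reindexing. -/
theorem exists_comp_of_eqOff {m m' : BasicMatrix} {W X : Fin 3} {F G : Fin 3 → Fin 3}
    {D : Set (Fin 3)} (hG : G = Function.update F X W) (hW : ∀ j ∈ D, j ≠ X → F j ≠ W)
    (h : EqOff W m m') :
    ∃ m'', EqOff X (m.comp F) m'' ∧ AgreeOn D (m'.comp G) m'' := by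
  obtain ⟨m'', h1, h2⟩ := exists_eqOff_agreeOn (m.comp F) (m'.comp G) X D (by
    intro i hi j hj
    have hi' : i ≠ X := hi.2
    have hj' : j ≠ X := hj.2
    simp only [comp, hG, Function.update_of_ne hi', Function.update_of_ne hj']
    exact h _ _ (hW i hi.1 hi') (hW j hj.1 hj'))
  exact ⟨m'', h1, fun i hi j hj => h2 i (Or.inr hi) j (Or.inr hj)⟩

open Classical in
-- The converse half: a change at `X` after reindexing is pulled back along a partial inverse of
-- `F`. Failure of injectivity is harmless, because indices identified by `F` are at distance `0`
-- and have equal rows.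
theorem exists_eqOff_of_comp {m m'' : BasicMatrix} {W X : Fin 3} {F G : Fin 3 → Fin 3}
    {D : Set (Fin 3)} (hG : G = Function.update F X W) (hW : ∀ j ∈ D, j ≠ X → F j ≠ W)
    (h : EqOff X (m.comp F) m'') :
    ∃ m', EqOff W m m' ∧ AgreeOn D (m'.comp G) m'' := by
  -- `e` sends `W` to `X` and picks a preimage in `D \ {X}` where there is one; the default value
  -- `X` is never relevant.
  let e : Fin 3 → Fin 3 := fun t =>
    if t = W then X else if h : ∃ j ∈ D, j ≠ X ∧ F j = t then h.choose else X
  have heW : e W = X := if_pos rfl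
  have he : ∀ j ∈ D, j ≠ X → e (F j) ≠ X ∧ F (e (F j)) = F j := by
    intro j hj hjX
    have hex : ∃ i ∈ D, i ≠ X ∧ F i = F j := ⟨j, hj, hjX, rfl⟩
    have : e (F j) = hex.choose := by
      simp only [e]
      rw [if_neg (hW j hj hjX), dif_pos hex]
    rw [this]
    exact hex.choose_spec.2
  have hsame : ∀ j ∈ D, j ≠ X → ∀ k, m''.entry (e (F j)) k = m''.entry j k := by
    intro j hj hjX k
    obtain ⟨h1, h2⟩ := he j hj hjX
    have h0 : m''.entry (e (F j)) j = 0 := by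
      rw [← h _ _ h1 hjX]
      simp only [comp]
      rw [h2, diag]
    have key : ∀ x y, K₁.R 0 x y → x = y := by unfold K₁; decide
    exact (key _ _ (h0 ▸ m''.triangle (e (F j)) j k)).symm
  obtain ⟨m', h1, h2⟩ := exists_eqOff_agreeOn m (m''.comp e) W (F '' (D \ {X})) (by
    rintro _ ⟨⟨i, hi, rfl⟩, -⟩ _ ⟨⟨j, hj, rfl⟩, -⟩
    obtain ⟨h1, h2⟩ := he i hi.1 hi.2
    obtain ⟨h3, h4⟩ := he j hj.1 hj.2
    have := h _ _ h1 h3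
    simp only [comp] at this ⊢
    rw [← this, h2, h4])
  have hmem : ∀ j ∈ D, G j ∈ insert W (F '' (D \ {X})) := by
    intro j hj
    by_cases hjX : j = X
    · subst hjX; simp [hG]
    · rw [hG, Function.update_of_ne hjX]
      exact Or.inr ⟨j, ⟨hj, hjX⟩, rfl⟩
  have hrow : ∀ j ∈ D, ∀ k, m''.entry (e (G j)) k = m''.entry j k := by
    intro j hj k
    by_cases hjX : j = X
    · subst hjX; simp [hG, heW]
    · rw [hG, Function.update_of_ne hjX, hsame j hj hjX]
  refine ⟨m', h1, fun i hi j hj => ?_⟩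
  have := h2 _ (hmem i hi) _ (hmem j hj)
  simp only [comp] at this ⊢
  rw [← this, hrow i hi, entry_symm, hrow j hj, entry_symm]

end BasicMatrix

end RelLogic

namespace RelLogic

/-! ### Variables occurring in formulas and closures -/

namespace Formula

theorem usesOnly_foldr_all {n : ℕ} {φ : Formula} {l : List ℕ} :
    (l.foldr all φ).UsesOnly n ↔ (∀ x ∈ l, x < n) ∧ φ.UsesOnly n := by
  induction l with
  | nil => simp
  | cons x l ih => simp [UsesOnly, ih, and_assoc]

theorem UsesOnly.lt_of_mem_fv {n x : ℕ} {φ : Formula} (h : φ.UsesOnly n) (hx : x ∈ φ.fv) :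
    x < n := by
  induction φ with
  | rel y A z =>
    simp only [fv, Finset.mem_insert, Finset.mem_singleton] at hx
    rcases hx with rfl | rfl
    exacts [h.1, h.2]
  | eqn A B => simp [fv] at hx
  | imp φ ψ ihφ ihψ =>
    rcases Finset.mem_union.1 hx with hx | hx
    exacts [ihφ h.1 hx, ihψ h.2 hx]
  | neg φ ih => exact ih h hx
  | all y φ ih => exact ih h.2 (Finset.mem_of_mem_erase hx)

theorem usesOnly_closure {n : ℕ} {φ : Formula} : φ.closure.UsesOnly n ↔ φ.UsesOnly n := by
  rw [closure, usesOnly_foldr_all]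
  exact and_iff_right_of_imp fun h x hx => h.lt_of_mem_fv (by simpa using hx)

theorem closure_eq_all_all {φ : Formula} (h : φ.fv = {0, 1}) :
    φ.closure = all 0 (all 1 φ) := by
  have : ({0, 1} : Finset ℕ).sort (· ≤ ·) = [0, 1] := by
    rw [Finset.sort_insert, Finset.sort_singleton] <;> simp
  rw [closure, h, this]
  rfl

theorem fv_iff_rel (A B : Predicate) : (iff (rel 0 A 1) (rel 0 B 1)).fv = {0, 1} := by
  simp [iff, fv]

theorem fresh_notMem (S : Finset ℕ) : fresh S ∉ S :=
  Nat.find_spec (Infinite.exists_notMem_finset S)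

end Formula

/-! ### Soundness of the three-variable calculus -/

open BasicMatrix Formula

/-- The index of a basic matrix that represents the variable `x < 3`. -/
def varIndex (x : ℕ) : Fin 3 := Fin.ofNat 3 x

theorem varIndex_val (i : Fin 3) : varIndex i.val = i := by
  revert i; decide

theorem val_varIndex {x : ℕ} (hx : x < 3) : (varIndex x).val = x := Nat.mod_eq_of_lt hx

theorem varIndex_inj {x y : ℕ} (hx : x < 3) (hy : y < 3) : varIndex x = varIndex y ↔ x = y :=
  ⟨fun h => by rw [← val_varIndex hx, h, val_varIndex hy], fun h => h ▸ rfl⟩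

namespace Formula

/-- Truth of a formula in three variables at a basic matrix. -/
def Truth (h : Predicate → Set (Fin 4)) : Formula → BasicMatrix → Prop
  | rel x A y, m => m.entry (varIndex x) (varIndex y) ∈ h A
  | eqn A B, _ => h A = h B
  | imp φ ψ, m => Truth h φ m → Truth h ψ m
  | neg φ, m => ¬ Truth h φ m
  | all x φ, m => ∀ m', EqOff (varIndex x) m m' → Truth h φ m'

variable {h : Predicate → Set (Fin 4)}

theorem truth_or {φ ψ : Formula} {m : BasicMatrix} :
    (or φ ψ).Truth h m ↔ φ.Truth h m ∨ ψ.Truth h m := by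
  simp only [or, Truth]; tauto

theorem truth_and {φ ψ : Formula} {m : BasicMatrix} :
    (and φ ψ).Truth h m ↔ φ.Truth h m ∧ ψ.Truth h m := by
  simp only [and, Truth]; tauto

theorem truth_iff {φ ψ : Formula} {m : BasicMatrix} :
    (iff φ ψ).Truth h m ↔ (φ.Truth h m ↔ ψ.Truth h m) := by
  simp only [iff, Truth]; tauto

theorem truth_ex {x : ℕ} {φ : Formula} {m : BasicMatrix} :
    (ex x φ).Truth h m ↔ ∃ m', EqOff (varIndex x) m m' ∧ φ.Truth h m' := by
  simp [ex, Truth]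

theorem truth_foldr_all {φ : Formula} (hφ : ∀ m, φ.Truth h m) (l : List ℕ) :
    ∀ m, (l.foldr all φ).Truth h m := by
  induction l with
  | nil => exact hφ
  | cons x l ih => exact fun m m' _ => ih m'

theorem truth_closure {φ : Formula} (hφ : ∀ m, φ.Truth h m) (m : BasicMatrix) :
    φ.closure.Truth h m :=
  truth_foldr_all hφ _ m

/-- The essential case is a quantifier on another variable, where the changes in the two directions
must be interchanged; `exists_eqOff_agreeOn` supplies the intermediate matrix. -/
theorem truth_eqOff {φ : Formula} (hφ : φ.UsesOnly 3) {x : ℕ} (hx : x < 3) (hxφ : x ∉ φ.fv) :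
    ∀ {m m' : BasicMatrix}, EqOff (varIndex x) m m' → φ.Truth h m → φ.Truth h m' := by
  induction φ with
  | rel y A z =>
    intro m m' hm ht
    simp only [fv, Finset.mem_insert, Finset.mem_singleton, not_or] at hxφ
    simp only [Truth] at ht ⊢
    rwa [← hm _ _ (mt (varIndex_inj hφ.1 hx).1 (Ne.symm hxφ.1))
      (mt (varIndex_inj hφ.2 hx).1 (Ne.symm hxφ.2))]
  | eqn A B => exact fun _ ht => ht
  | imp φ ψ ihφ ihψ =>
    intro m m' hm ht h1
    simp only [fv, Finset.mem_union, not_or] at hxφ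
    exact ihψ hφ.2 hxφ.2 hm (ht (ihφ hφ.1 hxφ.1 hm.symm h1))
  | neg φ ih => exact fun hm ht h1 => ht (ih hφ hxφ hm.symm h1)
  | all y φ ih =>
    intro m m' hm ht m'' hm'
    by_cases hxy : x = y
    · subst hxy
      exact ht _ (hm.trans hm')
    · have hxφ' : x ∉ φ.fv := fun h' => hxφ (Finset.mem_erase.2 ⟨hxy, h'⟩)
      obtain ⟨m₁, h1, h2⟩ := exists_eqOff_agreeOn m m'' (varIndex y) ({varIndex x}ᶜ) (by
        intro i hi j hj
        rw [hm i j hi.1 hj.1]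
        exact hm' i j hi.2 hj.2)
      have h3 : EqOff (varIndex x) m₁ m'' := fun i j hi hj =>
        (h2 i (Or.inr hi) j (Or.inr hj)).symm
      exact ih hφ.2 hxφ' h3 (ht _ h1)

/-- Indices that are not free are changed one at a time: with two of them any matrix is reachable,
with one a single change suffices, and with none the matrices coincide. -/
theorem truth_agreeOn {φ : Formula} (hφ : φ.UsesOnly 3) {m m' : BasicMatrix}
    (hm : AgreeOn (varIndex '' φ.fv) m m') (ht : φ.Truth h m) : φ.Truth h m' := by
  have hD : ∀ i, i ∉ varIndex '' φ.fv → i.val ∉ φ.fv := fun i hi h' =>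
    hi ⟨i.val, h', varIndex_val i⟩
  have step : ∀ i, i ∉ varIndex '' φ.fv → ∀ {m m'}, EqOff i m m' → φ.Truth h m → φ.Truth h m' :=
    fun i hi m m' he => truth_eqOff hφ i.isLt (hD i hi) (by rwa [varIndex_val])
  by_cases hx : ∃ x, x ∉ varIndex '' φ.fv
  · obtain ⟨x, hx⟩ := hx
    by_cases hy : ∃ y, y ∉ varIndex '' φ.fv ∧ y ≠ x
    · obtain ⟨y, hy, hyx⟩ := hy
      obtain ⟨m₁, h1, h2⟩ := exists_eqOff_eqOff m m' hyx
      exact step x hx h2 (step y hy h1 ht)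
    · push Not at hy
      exact step x hx (fun i j hi hj => hm i (by_contra fun h' => hi (hy i h'))
        j (by_contra fun h' => hj (hy j h'))) ht
  · push Not at hx
    exact hm.eq hx ▸ ht

/-- Substitution acts as reindexing. At a quantifier the possibly renamed variable `w` avoids the
images of the other free variables, as the two transfer lemmas require; the bound on the substituted
formula keeps `w` among the three indices. -/
theorem truth_subst {φ : Formula} (hφ : φ.UsesOnly 3) :
    ∀ {f : ℕ → ℕ}, (∀ j < 3, f j < 3) → (φ.subst f).UsesOnly 3 → ∀ m : BasicMatrix,
      (φ.subst f).Truth h m ↔ φ.Truth h (m.comp fun i => varIndex (f i)) := by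
  induction φ with
  | rel x A y =>
    intro f _ _ m
    simp only [subst, Truth, BasicMatrix.comp, val_varIndex hφ.1, val_varIndex hφ.2]
  | eqn A B => exact fun _ _ _ => Iff.rfl
  | imp φ ψ ihφ ihψ =>
    intro f hf hs m
    exact imp_congr (ihφ hφ.1 hf hs.1 m) (ihψ hφ.2 hf hs.2 m)
  | neg φ ih =>
    intro f hf hs m
    exact not_congr (ih hφ hf hs m)
  | all x φ ih =>
    intro f hf hs m
    simp only [subst] at hs ⊢
    generalize hw : (if x ∈ ((fv φ).erase x).image f then fresh (((fv φ).erase x).image f)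
      else x) = w at hs ⊢
    have hwS : w ∉ ((fv φ).erase x).image f := by
      rw [← hw]
      split_ifs with hx
      exacts [fresh_notMem _, hx]
    have hx3 : x < 3 := hφ.1
    have hw3 : w < 3 := hs.1
    have hg : ∀ j < 3, Function.update f x w j < 3 := by
      intro j hj
      by_cases hjx : j = x
      · subst hjx; simpa using hw3
      · simpa [hjx] using hf j hj
    have hG : (fun i : Fin 3 => varIndex (Function.update f x w i)) =
        Function.update (fun i : Fin 3 => varIndex (f i)) (varIndex x) (varIndex w) := by
      funext i
      by_cases hi : i = varIndex x
      · subst hi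
        simp [val_varIndex hx3]
      · have hi' : i.val ≠ x := fun h' => hi (by rw [← h', varIndex_val])
        simp [hi, hi']
    have hW : ∀ j ∈ varIndex '' φ.fv, j ≠ varIndex x → varIndex (f j) ≠ varIndex w := by
      rintro _ ⟨j, hj, rfl⟩ hjx heq
      have hj3 := hφ.2.lt_of_mem_fv hj
      rw [val_varIndex hj3, varIndex_inj (hf j hj3) hw3] at heq
      exact hwS (Finset.mem_image.2
        ⟨j, Finset.mem_erase.2 ⟨fun h' => hjx (h' ▸ rfl), hj⟩, heq⟩)
    constructor
    · intro ht m'' hm''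
      obtain ⟨m', h1, h2⟩ := exists_eqOff_of_comp hG hW hm''
      exact truth_agreeOn hφ.2 h2 ((ih hφ.2 hg hs.2 m').1 (ht m' h1))
    · intro ht m' hm'
      obtain ⟨m'', h1, h2⟩ := exists_comp_of_eqOff hG hW hm'
      exact (ih hφ.2 hg hs.2 m').2
        (truth_agreeOn hφ.2 (fun i hi j hj => (h2 i hi j hj).symm) (ht m'' h1))

/-- An entry `0` between `x` and `y` makes their rows equal, so replacing the index `x` by `y`
leaves the matrix unchanged. -/
theorem truth_replace {φ : Formula} (hφ : φ.UsesOnly 3) {x y : ℕ} (hy : y < 3)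
    (hs : (φ.replace x y).UsesOnly 3) {m : BasicMatrix}
    (h0 : m.entry (varIndex x) (varIndex y) = 0) (ht : φ.Truth h m) :
    (φ.replace x y).Truth h m := by
  refine (truth_subst hφ (fun j hj => ?_) hs m).2 ?_
  · by_cases hjx : j = x
    · subst hjx; simpa using hy
    · simpa [hjx] using hj
  · refine truth_agreeOn hφ (fun i _ j _ => ?_) ht
    have key : ∀ a b, K₁.R 0 a b → a = b := by unfold K₁; decide
    have hrow : ∀ i k : Fin 3,
        m.entry (varIndex (Function.update id x y i)) k = m.entry i k := by
      intro i k
      by_cases hi : i.val = x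
      · subst hi
        rw [varIndex_val] at h0
        have h1 := m.triangle i (varIndex y) k
        rw [h0] at h1
        simpa using key _ _ h1
      · simp [hi, varIndex_val]
    simp only [BasicMatrix.comp]
    rw [hrow, entry_symm m i (varIndex _), hrow, entry_symm]

end Formula

variable {h : Predicate → Set (Fin 4)}

theorem truth_comp_iff (hh : K₁.Cm.IsHom h) (A B : Predicate) (m : BasicMatrix) {x y z : Fin 3}
    (hyx : y ≠ x) (hyz : y ≠ z) :
    m.entry x z ∈ h (.comp A B) ↔
      ∃ m', EqOff y m m' ∧ m'.entry x y ∈ h A ∧ m'.entry y z ∈ h B := by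
  rw [hh.map_comp]
  constructor
  · rintro ⟨p, hp, q, hq, hR⟩
    suffices hm : ∃ m₁ : BasicMatrix, m₁.entry x y = p ∧ m₁.entry y z = q ∧
        m₁.entry x z = m.entry x z by
      obtain ⟨m₁, rfl, rfl, h3⟩ := hm
      have h3' := h3
      rw [entry_symm, entry_symm m] at h3'
      obtain ⟨m', h4, h5⟩ := exists_eqOff_agreeOn m m₁ y {x, z} (by
        rintro i ⟨rfl | rfl, -⟩ j ⟨rfl | rfl, -⟩ <;> simp [diag, h3, h3'])
      refine ⟨m', h4, ?_, ?_⟩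
      · rwa [← h5 x (by simp) y (by simp)]
      · rwa [← h5 y (by simp) z (by simp)]
    -- When the endpoints coincide, the product contains `0`, which forces `p = q`; any triangle
    -- with an edge `p` then works.
    by_cases hxz : x = z
    · subst hxz
      have key : ∀ a b, K₁.R a b 0 → a = b := by unfold K₁; decide
      rw [diag] at hR
      obtain rfl := key _ _ hR
      obtain ⟨w, hyw, hxw⟩ : ∃ w, y ≠ w ∧ x ≠ w := by
        clear hp hq hR
        revert x y
        decide
      obtain ⟨t, ht⟩ := K₁_exists_comp p p
      obtain ⟨m₁, h1, -, -⟩ := exists_of_triangle hyx.symm hxw hyw ht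
      exact ⟨m₁, h1, by rw [entry_symm, h1], by rw [diag, diag]⟩
    · obtain ⟨m₁, h1⟩ := exists_of_triangle hyx.symm hxz hyz hR
      exact ⟨m₁, h1⟩
  · rintro ⟨m', h1, h2, h3⟩
    refine ⟨_, h2, _, h3, ?_⟩
    rw [h1 x z hyx.symm hyz.symm]
    exact m'.triangle x y z

theorem truth_of_postulate (hh : K₁.Cm.IsHom h) {φ : Formula} (hφ : Postulate φ)
    (hn : φ.UsesOnly 3) (m : BasicMatrix) : φ.Truth h m := by
  have hzero : h .one = {0} := hh.map_one
  cases hφ with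
  | d5 A B =>
    rw [truth_iff, closure_eq_all_all (fv_iff_rel A B)]
    constructor
    · intro hAB m₁ _ m₂ _
      have hAB : h A = h B := hAB
      simp only [truth_iff, Truth, hAB]
    · intro ht
      -- The two quantifiers reach every matrix, and every atom occurs as the entry at `0, 1` of
      -- some matrix.
      have hall : ∀ m', (iff (rel 0 A 1) (rel 0 B 1)).Truth h m' := by
        intro m'
        obtain ⟨m₁, h1, h2⟩ := exists_eqOff_eqOff m m' (x := varIndex 0) (y := varIndex 1)
          (by decide)
        exact ht m₁ h1 m' h2
      change h A = h B
      ext p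
      obtain ⟨m', hm', -⟩ := exists_of_triangle (i := 0) (j := 1) (k := 2) (by decide)
        (by decide) (by decide) ((K₁_zero p p).2 rfl)
      have := hall m'
      rw [truth_iff] at this
      change m'.entry 0 1 ∈ h A ↔ m'.entry 0 1 ∈ h B at this
      rwa [hm'] at this
  | a1 φ ψ ξ => exact truth_closure (by exact fun m h1 h2 h3 => h2 (h1 h3)) m
  | a2 φ => exact truth_closure (by exact fun m h1 => by_contra fun h2 => h2 (h1 h2)) m
  | a3 φ ψ => exact truth_closure (by exact fun m h1 h2 => absurd h1 h2) m
  | a4 x y φ =>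
    refine truth_closure ?_ m
    intro m h1 m₁ hm₁ m₂ hm₂
    by_cases hxy : varIndex x = varIndex y
    · exact h1 m (EqOff.refl _ m) m₂ (hxy ▸ hm₁.trans (hxy ▸ hm₂))
    · obtain ⟨m', h2, h3⟩ := exists_eqOff_eqOff m m₂ hxy
      exact h1 m' h2 m₂ h3
  | a5 x φ ψ => exact truth_closure (by exact fun m h1 h2 m' hm' => h1 m' hm' (h2 m' hm')) m
  | a6 x φ => exact truth_closure (by exact fun m h1 => h1 m (EqOff.refl _ m)) m
  | a7 x φ hx =>
    rw [usesOnly_closure] at hn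
    exact truth_closure (by exact fun m h1 m' hm' => truth_eqOff hn.1 hn.2.1 hx hm' h1) m
  | a8 x y hxy =>
    rw [usesOnly_closure] at hn
    obtain ⟨hx, -, hy⟩ : x < 3 ∧ x < 3 ∧ y < 3 := hn
    refine truth_closure ?_ m
    intro m
    refine truth_ex.2 ?_
    -- The witness makes `x` a duplicate of `y`.
    refine ⟨m.comp (Function.update id (varIndex x) (varIndex y)), fun i j hi hj => ?_, ?_⟩
    · simp [BasicMatrix.comp, hi, hj]
    · have hne : varIndex y ≠ varIndex x := mt (varIndex_inj hy hx).1 hxy.symm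
      simp [Truth, BasicMatrix.comp, hne, diag, hzero]
  | a9 x y φ =>
    rw [usesOnly_closure] at hn
    obtain ⟨⟨-, hy⟩, hφ, hs⟩ := hn
    refine truth_closure ?_ m
    intro m h1 h2
    simp only [Truth, hzero, Set.mem_singleton_iff] at h1
    exact truth_replace hφ hy hs h1 h2
  | d1 A B =>
    refine truth_closure ?_ m
    intro m
    rw [truth_iff, truth_or]
    simp only [Truth, hh.map_add]
    rfl
  | d2 A =>
    refine truth_closure ?_ m
    intro m
    rw [truth_iff]
    simp only [Truth, hh.map_compl]
    rfl
  | d3 A B =>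
    refine truth_closure ?_ m
    intro m
    rw [truth_iff, truth_ex]
    simp only [truth_and]
    exact truth_comp_iff hh A B m (by decide) (by decide)
  | d4 A =>
    refine truth_closure ?_ m
    intro m
    rw [truth_iff]
    simp only [Truth, hh.map_conv, K₁_conv]
    rw [entry_symm]

theorem truth_of_proves (hh : K₁.Cm.IsHom h) {φ : Formula} (hφ : Proves 3 ∅ φ)
    (m : BasicMatrix) : φ.Truth h m := by
  induction hφ with
  | post φ hφ hn => exact truth_of_postulate hh hφ hn m
  | hyp e he => exact he.elim
  | mp φ ψ _ _ ih₁ ih₂ => exact ih₁ ih₂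

theorem valid_of_mem_CT_three {A : Predicate} (hA : A ∈ CT 3 ∅) : K₁.Valid A := by
  intro h hh
  have h1 : h (.add .one A) = h A := truth_of_proves hh hA
    ⟨fun _ _ => 0, fun _ => rfl, fun _ _ _ => K₁_self 0⟩
  rw [hh.map_add, hh.map_one] at h1
  exact Set.union_eq_right.1 h1

end RelLogic

namespace RelLogic

open BasicMatrix

/-! ### Soundness of the three-variable sequent calculus -/

/-- Truth of `x A y` at a basic matrix. -/
def Fm.Sat (h : Predicate → Set (Fin 4)) (m : BasicMatrix) (a : Fm) : Prop :=
  m.entry (varIndex a.src) (varIndex a.tgt) ∈ h a.pred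

theorem InVars.union {n : ℕ} {Γ Δ : Set Fm} (hΓ : InVars n Γ) (hΔ : InVars n Δ) :
    InVars n (Γ ∪ Δ) := fun a ha => ha.elim (hΓ a) (hΔ a)

theorem InVars.mono {n : ℕ} {Γ Δ : Set Fm} (hΔ : InVars n Δ) (h : Γ ⊆ Δ) : InVars n Γ :=
  fun a ha => hΔ a (h ha)

theorem inVars_singleton {n : ℕ} {a : Fm} : InVars n {a} ↔ a.src < n ∧ a.tgt < n := by
  simp [InVars]

theorem inVars_union {n : ℕ} {Γ Δ : Set Fm} :
    InVars n (Γ ∪ Δ) ↔ InVars n Γ ∧ InVars n Δ :=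
  ⟨fun h => ⟨h.mono Set.subset_union_left, h.mono Set.subset_union_right⟩, fun h => h.1.union h.2⟩

theorem inVars_pair {n : ℕ} {a b : Fm} :
    InVars n {a, b} ↔ (a.src < n ∧ a.tgt < n) ∧ b.src < n ∧ b.tgt < n := by
  simp [InVars]

theorem SeqProves.inVars {Ψ : Set Equation} {Γ Δ : Set Fm} {n : ℕ}
    (hs : SeqProves n (corrSequents n Ψ) Γ Δ) : InVars n Γ ∧ InVars n Δ := by
  induction hs with
  | hyp Γ Δ hs =>
    obtain ⟨A, B, x, y, Γ, Δ, -, hx, hy, hΓ, hΔ, heq⟩ := hs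
    obtain ⟨rfl, rfl⟩ := Prod.mk.inj heq
    simp only [inVars_union, inVars_singleton]
    tauto
  | _ =>
    try simp only [inVars_union, inVars_singleton, inVars_pair] at *
    tauto

theorem SeqProves.sound {h : Predicate → Set (Fin 4)} (hh : K₁.Cm.IsHom h) {Ψ : Set Equation}
    (hΨ : ∀ e ∈ Ψ, h e.1 = h e.2) {Γ Δ : Set Fm} (hs : SeqProves 3 (corrSequents 3 Ψ) Γ Δ) :
    ∀ m, (∀ a ∈ Γ, a.Sat h m) → ∃ a ∈ Δ, a.Sat h m := by
  have hinf : ∀ A B, h (.inf A B) = h A ∩ h B := by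
    intro A B
    rw [Predicate.inf, hh.map_compl, hh.map_add, hh.map_compl, hh.map_compl]
    change ((h A)ᶜ ∪ (h B)ᶜ)ᶜ = _
    rw [Set.compl_union, compl_compl, compl_compl]
  have hadd : ∀ A B, h (.add A B) = h A ∪ h B := hh.map_add
  have hcompl : ∀ A, h (.compl A) = (h A)ᶜ := hh.map_compl
  have hone : h .one = {0} := hh.map_one
  have hconv : ∀ A, h (.conv A) = h A := fun A => by rw [hh.map_conv, K₁_conv]
  induction hs with
  | hyp Γ Δ hs =>
    obtain ⟨A, B, x, y, Γ, Δ, hAB, -, -, -, -, heq⟩ := hs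
    obtain ⟨rfl, rfl⟩ := Prod.mk.inj heq
    have hAB : h A = h B := hAB.elim (fun h1 => hΨ _ h1) fun h1 => (hΨ _ h1).symm
    intro m hm
    refine ⟨⟨x, B, y⟩, Or.inl rfl, ?_⟩
    have := hm ⟨x, A, y⟩ (Or.inl rfl)
    rwa [Fm.Sat, hAB] at this
  | start Γ Δ _ _ hne =>
    intro m hm
    obtain ⟨a, ha, ha'⟩ := hne
    exact ⟨a, ha', hm a ha⟩
  | one_right Γ Δ x _ _ _ =>
    intro m _
    exact ⟨_, Or.inr rfl, by simp [Fm.Sat, diag, hone]⟩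
  | cut Γ Γ' Δ Δ' a _ _ ih₁ ih₂ =>
    intro m hm
    obtain ⟨b, hb | rfl, hb'⟩ := ih₁ m fun a ha => hm a (Or.inl ha)
    · exact ⟨b, Or.inl hb, hb'⟩
    · obtain ⟨c, hc, hc'⟩ := ih₂ m (by
        rintro c (rfl | hc)
        exacts [hb', hm c (Or.inr hc)])
      exact ⟨c, Or.inr hc, hc'⟩
  | one_left Γ Δ x y z A _ _ ih =>
    intro m hm
    refine ih m ?_
    rintro c (rfl | hc)
    · have h1 : m.entry (varIndex x) (varIndex z) ∈ h A := hm ⟨x, A, z⟩ (by simp)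
      have h2 : m.entry (varIndex z) (varIndex y) ∈ h .one := hm ⟨z, .one, y⟩ (by simp)
      rw [hone, Set.mem_singleton_iff] at h2
      have h3 := m.triangle (varIndex x) (varIndex z) (varIndex y)
      rw [h2, K₁_zero] at h3
      rwa [Fm.Sat, ← h3]
    · exact hm c (Or.inr hc)
  | add_left Γ Γ' Δ Δ' x y A B _ _ ih₁ ih₂ =>
    intro m hm
    have h1 : _ ∈ h (.add A B) := hm ⟨x, .add A B, y⟩ (by simp)
    rw [hadd] at h1
    rcases h1 with h1 | h1
    · obtain ⟨c, hc, hc'⟩ := ih₁ m (by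
        rintro c (rfl | hc)
        exacts [h1, hm c (Or.inl (Or.inr hc))])
      exact ⟨c, Or.inl hc, hc'⟩
    · obtain ⟨c, hc, hc'⟩ := ih₂ m (by
        rintro c (rfl | hc)
        exacts [h1, hm c (Or.inr hc)])
      exact ⟨c, Or.inr hc, hc'⟩
  | add_right Γ Δ x y A B _ ih =>
    intro m hm
    obtain ⟨c, hc | rfl | rfl, hc'⟩ := ih m hm
    · exact ⟨c, Or.inl hc, hc'⟩
    · exact ⟨_, Or.inr rfl, by rw [Fm.Sat, hadd]; exact Or.inl hc'⟩
    · exact ⟨_, Or.inr rfl, by rw [Fm.Sat, hadd]; exact Or.inr hc'⟩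
  | inf_left Γ Δ x y A B _ ih =>
    intro m hm
    have h1 : _ ∈ h (.inf A B) := hm ⟨x, .inf A B, y⟩ (by simp)
    rw [hinf] at h1
    refine ih m ?_
    rintro c (hc | rfl | rfl)
    exacts [hm c (Or.inl hc), h1.1, h1.2]
  | inf_right Γ Γ' Δ Δ' x y A B _ _ ih₁ ih₂ =>
    intro m hm
    obtain ⟨c, hc | rfl, hc'⟩ := ih₁ m fun a ha => hm a (Or.inl ha)
    · exact ⟨c, Or.inl (Or.inl hc), hc'⟩
    obtain ⟨d, hd | rfl, hd'⟩ := ih₂ m fun a ha => hm a (Or.inr ha)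
    · exact ⟨d, Or.inl (Or.inr hd), hd'⟩
    exact ⟨_, Or.inr rfl, by rw [Fm.Sat, hinf]; exact ⟨hc', hd'⟩⟩
  | compl_left Γ Δ x y A _ ih =>
    intro m hm
    have h1 : _ ∈ h (.compl A) := hm ⟨x, .compl A, y⟩ (by simp)
    rw [hcompl] at h1
    obtain ⟨c, hc | rfl, hc'⟩ := ih m fun a ha => hm a (Or.inr ha)
    · exact ⟨c, hc, hc'⟩
    · exact absurd hc' h1
  | compl_right Γ Δ x y A _ ih =>
    intro m hm
    by_cases h1 : m.entry (varIndex x) (varIndex y) ∈ h A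
    · obtain ⟨c, hc, hc'⟩ := ih m (by
        rintro c (rfl | hc)
        exacts [h1, hm c hc])
      exact ⟨c, Or.inl hc, hc'⟩
    · exact ⟨_, Or.inr rfl, by rw [Fm.Sat, hcompl]; exact h1⟩
  | comp_left Γ Δ x y z A B hyx hyz hΓ hΔ hs ih =>
    intro m hm
    -- Indices are taken modulo 3, so distinct variables are known to have distinct indices only
    -- below 3.
    have hv := hs.inVars
    simp only [inVars_union, inVars_pair] at hv
    obtain ⟨⟨⟨⟨hx, hy⟩, -, hz⟩, hvΓ⟩, hvΔ⟩ := hv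
    have h1 : _ ∈ h (.comp A B) := hm ⟨x, .comp A B, z⟩ (by simp)
    rw [truth_comp_iff hh A B m (mt (varIndex_inj hy hx).1 hyx)
      (mt (varIndex_inj hy hz).1 hyz)] at h1
    obtain ⟨m', hmm', h2, h3⟩ := h1
    have keep : ∀ Θ, InVars 3 Θ → Avoids y Θ → ∀ c ∈ Θ, (c.Sat h m ↔ c.Sat h m') := by
      intro Θ hv hΘ c hc
      rw [Fm.Sat, Fm.Sat, hmm' _ _ (mt (varIndex_inj (hv c hc).1 hy).1 (hΘ c hc).1)
        (mt (varIndex_inj (hv c hc).2 hy).1 (hΘ c hc).2)]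
    obtain ⟨c, hc, hc'⟩ := ih m' (by
      rintro c ((rfl | rfl) | hc)
      exacts [h2, h3, (keep Γ hvΓ hΓ c hc).1 (hm c (Or.inr hc))])
    exact ⟨c, hc, (keep Δ hvΔ hΔ c hc).2 hc'⟩
  | comp_right Γ Γ' Δ Δ' x y z A B _ _ ih₁ ih₂ =>
    intro m hm
    obtain ⟨c, hc | rfl, hc'⟩ := ih₁ m fun a ha => hm a (Or.inl ha)
    · exact ⟨c, Or.inl (Or.inl hc), hc'⟩
    obtain ⟨d, hd | rfl, hd'⟩ := ih₂ m fun a ha => hm a (Or.inr ha)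
    · exact ⟨d, Or.inl (Or.inr hd), hd'⟩
    exact ⟨_, Or.inr rfl, by
      rw [Fm.Sat, hh.map_comp]; exact ⟨_, hc', _, hd', m.triangle _ _ _⟩⟩
  | conv_left Γ Δ x y A _ ih =>
    intro m hm
    have h1 : m.entry (varIndex y) (varIndex x) ∈ h (.conv A) := hm ⟨y, .conv A, x⟩ (by simp)
    rw [hconv, entry_symm] at h1
    refine ih m ?_
    rintro c (rfl | hc)
    exacts [h1, hm c (Or.inr hc)]
  | conv_right Γ Δ x y A _ ih =>
    intro m hm
    obtain ⟨c, hc | rfl, hc'⟩ := ih m hm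
    · exact ⟨c, Or.inl hc, hc'⟩
    · refine ⟨_, Or.inr rfl, ?_⟩
      rw [Fm.Sat, hconv, entry_symm]
      exact hc'

theorem valid_of_nProvable_three {A : Predicate}
    (hA : NProvable 3 (densityEqs ∪ symmEqs) A) : K₁.Valid A := by
  intro h hh
  have hΨ : ∀ e ∈ densityEqs ∪ symmEqs, h e.1 = h e.2 := by
    rintro _ (⟨A, rfl⟩ | ⟨A, rfl⟩)
    · simp only [incl, hh.map_add, hh.map_comp]
      exact K₁_dense _
    · simp only [hh.map_conv, K₁_conv]
  -- A diagonal entry is `0`, so truth of `v_0 A v_0` at any one matrix, here the zero matrix, gives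
  -- validity.
  obtain ⟨_, rfl, h1⟩ := SeqProves.sound hh hΨ hA
    ⟨fun _ _ => 0, fun _ => rfl, fun _ _ _ => K₁_self 0⟩ (by simp)
  rintro _ rfl
  exact h1

end RelLogic

namespace RelLogic

open Formula

/-! ### Provability of open formulas -/

namespace Formula

theorem fv_foldr_all (φ : Formula) (l : List ℕ) : (l.foldr all φ).fv = φ.fv \ l.toFinset := by
  induction l with
  | nil => simp
  | cons x l ih =>
    rw [List.foldr_cons, fv, ih, List.toFinset_cons]
    ext y
    simp only [Finset.mem_erase, Finset.mem_sdiff, Finset.mem_insert]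
    tauto

/-- Every free variable of `φ` is a member of `l`. -/
def CoveredBy (φ : Formula) (l : List ℕ) : Prop := ∀ x ∈ φ.fv, x ∈ l

theorem coveredBy_iff {φ : Formula} {l : List ℕ} :
    φ.CoveredBy l ↔ (l.foldr all φ).fv = ∅ := by
  rw [fv_foldr_all, Finset.sdiff_eq_empty_iff_subset]
  simp [CoveredBy, Finset.subset_iff]

theorem coveredBy_all {φ : Formula} {l : List ℕ} {x : ℕ} :
    (all x φ).CoveredBy l ↔ φ.CoveredBy (l ++ [x]) := by
  rw [coveredBy_iff, coveredBy_iff, List.foldr_append]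
  rfl

theorem coveredBy_foldr_all {φ : Formula} {l l' : List ℕ} :
    (l'.foldr all φ).CoveredBy l ↔ φ.CoveredBy (l ++ l') := by
  rw [coveredBy_iff, coveredBy_iff, List.foldr_append]

theorem coveredBy_imp {φ ψ : Formula} {l : List ℕ} :
    (imp φ ψ).CoveredBy l ↔ φ.CoveredBy l ∧ ψ.CoveredBy l := by
  simp only [CoveredBy, fv, Finset.mem_union]
  exact ⟨fun h => ⟨fun x hx => h x (Or.inl hx), fun x hx => h x (Or.inr hx)⟩,
    fun h x hx => hx.elim (h.1 x) (h.2 x)⟩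

theorem closure_of_fv_eq_empty {φ : Formula} (h : φ.fv = ∅) : φ.closure = φ := by
  rw [closure, h, Finset.sort_empty]
  rfl

theorem fv_closure (φ : Formula) : φ.closure.fv = ∅ := by
  rw [Formula.closure, ← coveredBy_iff]
  intro x hx
  simpa using hx

/-- Up to order, a covering prefix is the prefix of the universal closure preceded by vacuous
quantifiers `r`. -/
theorem CoveredBy.exists_perm {φ : Formula} {l : List ℕ} (h : φ.CoveredBy l) :
    ∃ r ⊆ l, (r ++ φ.fv.sort (· ≤ ·)).Perm l :=
  ⟨l.diff (φ.fv.sort (· ≤ ·)), List.diff_subset _ _,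
    List.perm_append_comm.trans (List.subperm_append_diff_self_of_count_le
      (List.subperm_ext_iff.1 (List.Nodup.subperm (Finset.sort_nodup _ _)
        fun x hx => h x (by simpa using hx))))⟩

end Formula

variable {n : ℕ} {Ψ : Set Equation}

namespace Proves

theorem usesOnly {φ : Formula} (h : Proves n Ψ φ) : φ.UsesOnly n := by
  induction h with
  | post φ _ hn => exact hn
  | hyp e _ => trivial
  | mp φ ψ _ _ ih _ => exact ih.2

theorem all_of_sentence {φ : Formula} (h : Proves n Ψ φ) (hφ : φ.fv = ∅) {x : ℕ} (hx : x < n) :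
    Proves n Ψ (all x φ) := by
  have h1 := Postulate.a7 x φ (by simp [hφ])
  rw [closure_of_fv_eq_empty (by simp [fv, hφ])] at h1
  exact mp _ _ (post _ h1 ⟨h.usesOnly, hx, h.usesOnly⟩) h

theorem of_all_sentence {φ : Formula} {x : ℕ} (h : Proves n Ψ (all x φ)) (hφ : φ.fv = ∅) :
    Proves n Ψ φ := by
  have h1 := Postulate.a6 x φ
  rw [closure_of_fv_eq_empty (by simp [fv, hφ])] at h1
  exact mp _ _ (post _ h1 ⟨h.usesOnly, h.usesOnly.2⟩) h

theorem foldr_all_of_sentence {φ : Formula} (h : Proves n Ψ φ) (hφ : φ.fv = ∅) {l : List ℕ}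
    (hl : ∀ x ∈ l, x < n) : Proves n Ψ (l.foldr all φ) := by
  induction l with
  | nil => exact h
  | cons x l ih =>
    refine (ih fun y hy => hl y (by simp [hy])).all_of_sentence ?_ (hl x (by simp))
    rw [fv_foldr_all, hφ, Finset.empty_sdiff]

theorem of_foldr_all_sentence {φ : Formula} (hφ : φ.fv = ∅) {l : List ℕ}
    (h : Proves n Ψ (l.foldr all φ)) : Proves n Ψ φ := by
  induction l with
  | nil => exact h
  | cons x l ih => exact ih (h.of_all_sentence (by rw [fv_foldr_all, hφ, Finset.empty_sdiff]))

/-- Closed theorems can be weakened to the prefix `l`. -/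
def Lifts (n : ℕ) (Ψ : Set Equation) (l : List ℕ) : Prop :=
  ∀ φ : Formula, φ.CoveredBy l → Proves n Ψ φ.closure → Proves n Ψ (l.foldr all φ)

/-- Modus ponens under the prefix `l`. -/
def Detaches (n : ℕ) (Ψ : Set Equation) (l : List ℕ) : Prop :=
  ∀ φ ψ : Formula, φ.CoveredBy l → ψ.CoveredBy l → Proves n Ψ (l.foldr all (imp φ ψ)) →
    Proves n Ψ (l.foldr all φ) → Proves n Ψ (l.foldr all ψ)

/-- Interchanging two adjacent quantifiers below `l₀` uses scheme `a4` weakened to `l₀` and detached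
there; `l₀` is strictly shorter than the whole prefix. -/
theorem foldr_all_perm {N : ℕ}
    (hN : ∀ l : List ℕ, l.length < N → (∀ x ∈ l, x < n) → Lifts n Ψ l ∧ Detaches n Ψ l)
    {l l' : List ℕ} (hp : l.Perm l') :
    ∀ (l₀ : List ℕ) {φ : Formula}, (l₀ ++ l).length ≤ N → φ.CoveredBy (l₀ ++ l) →
      Proves n Ψ ((l₀ ++ l).foldr all φ) → Proves n Ψ ((l₀ ++ l').foldr all φ) := by
  induction hp with
  | nil => exact fun _ _ _ _ h => h
  | cons x _ ih =>
    intro l₀ φ hlen hc h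
    rw [List.append_cons] at hlen hc h ⊢
    exact ih _ hlen hc h
  | swap x y l =>
    intro l₀ φ hlen hc h
    have hvars := (usesOnly_foldr_all.1 h.usesOnly).1
    have hφ := (usesOnly_foldr_all.1 h.usesOnly).2
    have hl₀ : ∀ z ∈ l₀, z < n := fun z hz => hvars z (by simp [hz])
    have hx : x < n := hvars x (by simp)
    have hy : y < n := hvars y (by simp)
    have hl : (l.foldr all φ).UsesOnly n :=
      usesOnly_foldr_all.2 ⟨fun z hz => hvars z (by simp [hz]), hφ⟩
    obtain ⟨hlift, hdet⟩ := hN l₀ (by simp at hlen; omega) hl₀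
    have hc1 : (all y (all x (l.foldr all φ))).CoveredBy l₀ := by
      rw [coveredBy_all, coveredBy_all, coveredBy_foldr_all]
      simpa using hc
    have hc2 : (all x (all y (l.foldr all φ))).CoveredBy l₀ := by
      rw [coveredBy_all, coveredBy_all, coveredBy_foldr_all]
      intro z hz
      have := hc z hz
      simp only [List.mem_append, List.mem_cons] at this ⊢
      tauto
    rw [List.foldr_append] at h ⊢
    refine hdet _ _ hc1 hc2 (hlift _ (coveredBy_imp.2 ⟨hc1, hc2⟩)
      (post _ (Postulate.a4 y x _) (usesOnly_closure.2 ?_))) h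
    exact ⟨⟨hy, hx, hl⟩, hx, hy, hl⟩
  | trans h₁ _ ih₁ ih₂ =>
    intro l₀ φ hlen hc h
    refine ih₂ l₀ ?_ ?_ (ih₁ l₀ hlen hc h)
    · simpa [h₁.length_eq] using hlen
    · intro z hz
      have := hc z hz
      simpa [h₁.mem_iff] using this

/-- Both properties are proved together by induction on length. Lifting adds vacuous quantifiers in
front and permutes them into place; detaching splits off the innermost quantifier and distributes it
by `a5`. Each needs both properties for shorter prefixes only. -/
theorem lifts_and_detaches (N : ℕ) :
    ∀ l : List ℕ, l.length < N → (∀ x ∈ l, x < n) → Lifts n Ψ l ∧ Detaches n Ψ l := by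
  induction N with
  | zero => exact fun l hl => absurd hl (Nat.not_lt_zero _)
  | succ N ih =>
    intro l hl hvars
    have hlN : l.length ≤ N := Nat.lt_succ_iff.1 hl
    constructor
    · intro φ hc h
      obtain ⟨r, hr, hperm⟩ := hc.exists_perm
      have h1 := h.foldr_all_of_sentence φ.fv_closure fun x hx => hvars x (hr hx)
      rw [Formula.closure, ← List.foldr_append] at h1
      refine foldr_all_perm ih hperm [] ?_ ?_ h1
      · simpa [hperm.length_eq] using hlN
      · intro x hx
        simp [hx]
    · intro φ ψ hcφ hcψ h₁ h₂
      rcases List.eq_nil_or_concat l with rfl | ⟨l₀, x, rfl⟩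
      · exact mp _ _ h₁ h₂
      rw [List.concat_eq_append] at *
      have hlt : l₀.length < N := by simp at hlN; omega
      obtain ⟨hlift, hdet⟩ := ih l₀ hlt fun y hy => hvars y (by simp [hy])
      have hu := (usesOnly_foldr_all.1 h₁.usesOnly).2
      have hx : x < n := hvars x (by simp)
      rw [List.foldr_append] at h₁ h₂ ⊢
      have c1 : (all x (imp φ ψ)).CoveredBy l₀ :=
        coveredBy_all.2 (coveredBy_imp.2 ⟨hcφ, hcψ⟩)
      have c2 : (all x φ).CoveredBy l₀ := coveredBy_all.2 hcφ
      have c3 : (all x ψ).CoveredBy l₀ := coveredBy_all.2 hcψ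
      have c4 : (imp (all x φ) (all x ψ)).CoveredBy l₀ := coveredBy_imp.2 ⟨c2, c3⟩
      refine hdet _ _ c2 c3 (hdet _ _ c1 c4 (hlift _ (coveredBy_imp.2 ⟨c1, c4⟩) (post _
        (Postulate.a5 x φ ψ) (usesOnly_closure.2 ?_))) h₁) h₂
      exact ⟨⟨hx, hu⟩, ⟨hx, hu.1⟩, hx, hu.2⟩

end Proves

/-- `φ` holds under all quantifiers: provability of an open formula. -/
def Thm (n : ℕ) (Ψ : Set Equation) (φ : Formula) : Prop :=
  Proves n Ψ ((List.range n).foldr all φ)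

namespace Thm

variable {φ ψ : Formula}

theorem usesOnly (h : Thm n Ψ φ) : φ.UsesOnly n := (usesOnly_foldr_all.1 (Proves.usesOnly h)).2

theorem coveredBy_range (h : φ.UsesOnly n) : φ.CoveredBy (List.range n) := fun _ hx =>
  List.mem_range.2 (h.lt_of_mem_fv hx)

theorem mp (h₁ : Thm n Ψ (imp φ ψ)) (h₂ : Thm n Ψ φ) : Thm n Ψ ψ :=
  (Proves.lifts_and_detaches (n + 1) (List.range n) (by simp) (by simp)).2 φ ψ
    (coveredBy_range h₂.usesOnly) (coveredBy_range h₁.usesOnly.2) h₁ h₂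

theorem of_closure (h : Proves n Ψ φ.closure) : Thm n Ψ φ :=
  (Proves.lifts_and_detaches (n + 1) (List.range n) (by simp) (by simp)).1 φ
    (coveredBy_range (usesOnly_closure.1 h.usesOnly)) h

theorem of_postulate (h : Postulate φ.closure) (hn : φ.UsesOnly n) : Thm n Ψ φ :=
  of_closure (Proves.post _ h (usesOnly_closure.2 hn))

/-- The quantifier is vacuous in front of the closed formula and is then permuted to the innermost
position. -/
theorem gen (h : Thm n Ψ φ) {x : ℕ} (hx : x < n) : Thm n Ψ (all x φ) := by
  have h1 := Proves.all_of_sentence h (coveredBy_iff.1 (coveredBy_range h.usesOnly)) hx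
  have h2 := Proves.foldr_all_perm (Proves.lifts_and_detaches _)
    (l := x :: List.range n) (l' := List.range n ++ [x]) (List.perm_append_singleton _ _).symm []
    le_rfl (fun y hy => by simp [coveredBy_range h.usesOnly y hy]) h1
  rwa [List.nil_append, List.foldr_append] at h2

theorem closure (h : Thm n Ψ φ) : Proves n Ψ φ.closure := by
  obtain ⟨r, -, hperm⟩ := (coveredBy_range h.usesOnly).exists_perm
  have h1 := Proves.foldr_all_perm (Proves.lifts_and_detaches _) hperm.symm [] le_rfl
    (coveredBy_range h.usesOnly) h
  rw [List.nil_append, List.foldr_append] at h1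
  exact Proves.of_foldr_all_sentence φ.fv_closure h1

end Thm

end RelLogic

namespace RelLogic

/-! ### Completeness of Łukasiewicz's propositional axioms -/

/-- The set `T` of theorems contains Łukasiewicz's axioms and is closed under modus ponens. -/
structure IsLukasiewicz {α : Type*} (imp : α → α → α) (neg : α → α) (T : Set α) : Prop where
  mp : ∀ {a b}, imp a b ∈ T → a ∈ T → b ∈ T
  syll : ∀ a b c, imp (imp a b) (imp (imp b c) (imp a c)) ∈ T
  clavius : ∀ a, imp (imp (neg a) a) a ∈ T
  explosion : ∀ a b, imp a (imp (neg a) b) ∈ T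

namespace IsLukasiewicz

variable {α : Type*} {imp : α → α → α} {neg : α → α} {T : Set α}

theorem trans (h : IsLukasiewicz imp neg T) {a b c : α} (h₁ : imp a b ∈ T) (h₂ : imp b c ∈ T) :
    imp a c ∈ T := h.mp (h.mp (h.syll a b c) h₁) h₂

theorem imp_neg_syll (h : IsLukasiewicz imp neg T) (a b c d : α) :
    imp (imp a (neg b)) (imp (imp (imp a c) d) (imp b d)) ∈ T :=
  h.trans (h.trans (h.syll a (neg b) c)
    (h.mp (h.syll b (imp (neg b) c) (imp a c)) (h.explosion b c))) (h.syll b (imp a c) d)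

theorem explosion_syll (h : IsLukasiewicz imp neg T) (a b c d : α) :
    imp a (imp (imp (imp (neg a) b) c) (imp d c)) ∈ T :=
  h.trans (h.explosion a (neg d)) (h.imp_neg_syll (neg a) d b c)

/-- For a theorem `t`, `t → b` yields `¬b → b` once `¬b → t` is known. Weakening is not yet
available, so `¬b → t` comes from `explosion_syll` with `t` an instance of Clavius's law. -/
theorem of_clavius_imp (h : IsLukasiewicz imp neg T) (a b : α) :
    imp (imp (imp (imp (neg a) a) a) b) b ∈ T :=
  h.trans (h.mp (h.syll (neg b) (imp (imp (neg a) a) a) b)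
    (h.mp (h.mp (h.explosion_syll (imp (imp (neg a) a) a) (imp (imp (neg a) a) a)
      (imp (imp (neg a) a) a) (neg b)) (h.clavius a)) (h.clavius _))) (h.clavius b)

theorem weaken (h : IsLukasiewicz imp neg T) (a b : α) : imp a (imp b a) ∈ T :=
  h.trans (h.explosion_syll a a a b) (h.of_clavius_imp a (imp b a))

theorem peirce (h : IsLukasiewicz imp neg T) (a b : α) : imp (imp (imp a b) a) a ∈ T := by
  have h1 : imp (neg a) (imp a b) ∈ T :=
    h.trans (h.trans (h.weaken (neg a) (neg b)) (h.imp_neg_syll (neg b) a b b))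
      (h.of_clavius_imp b (imp a b))
  exact h.trans (h.mp (h.syll (neg a) (imp a b) a) h1) (h.clavius a)

theorem contract (h : IsLukasiewicz imp neg T) (a b : α) :
    imp (imp a (imp a b)) (imp a b) ∈ T :=
  h.trans (h.syll a (imp a b) b) (h.peirce (imp a b) b)

theorem modus (h : IsLukasiewicz imp neg T) (a b : α) : imp a (imp (imp a b) b) ∈ T :=
  h.trans (h.trans (h.weaken a (imp a b)) (h.syll (imp a b) a b)) (h.contract (imp a b) b)

theorem swap (h : IsLukasiewicz imp neg T) (a b c : α) :
    imp (imp a (imp b c)) (imp b (imp a c)) ∈ T :=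
  h.trans (h.syll a (imp b c) c) (h.mp (h.syll b (imp (imp b c) c) (imp a c)) (h.modus b c))

theorem pre (h : IsLukasiewicz imp neg T) (a b c : α) :
    imp (imp a b) (imp (imp c a) (imp c b)) ∈ T :=
  h.mp (h.swap _ _ _) (h.syll c a b)

theorem distrib (h : IsLukasiewicz imp neg T) (a b c : α) :
    imp (imp a (imp b c)) (imp (imp a b) (imp a c)) ∈ T :=
  h.trans (h.swap a b c) (h.trans (h.pre b (imp a c) a)
    (h.mp (h.pre _ _ (imp a b)) (h.contract a c)))

theorem refl (h : IsLukasiewicz imp neg T) (a : α) : imp a a ∈ T :=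
  h.mp (h.contract a a) (h.weaken a a)

/-- The consequences of an additional hypothesis. -/
theorem adjoin (h : IsLukasiewicz imp neg T) (a : α) :
    IsLukasiewicz imp neg {b | imp a b ∈ T} where
  mp h₁ h₂ := h.mp (h.mp (h.distrib a _ _) h₁) h₂
  syll b c d := h.mp (h.weaken _ _) (h.syll b c d)
  clavius b := h.mp (h.weaken _ _) (h.clavius b)
  explosion b c := h.mp (h.weaken _ _) (h.explosion b c)

/-- Lindenbaum's construction: a maximal theory omitting `p` is a Boolean valuation, since every `a`
outside it implies `p` by the deduction theorem `adjoin`. -/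
theorem exists_valuation (h : IsLukasiewicz imp neg T) {p : α} (hp : p ∉ T) :
    ∃ v : Set α, (∀ a b, imp a b ∈ v ↔ (a ∈ v → b ∈ v)) ∧ (∀ a, neg a ∈ v ↔ a ∉ v) ∧
      T ⊆ v ∧ p ∉ v := by
  obtain ⟨M, hTM, hM⟩ := zorn_subset_nonempty {M | IsLukasiewicz imp neg M ∧ p ∉ M} (by
    rintro c hc hchain ⟨M₀, hM₀⟩
    refine ⟨⋃₀ c, ⟨⟨?_, ?_, ?_, ?_⟩, ?_⟩, fun s hs => Set.subset_sUnion_of_mem hs⟩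
    · rintro a b ⟨M₁, h₁, h₁'⟩ ⟨M₂, h₂, h₂'⟩
      rcases hchain.total h₁ h₂ with hle | hle
      · exact ⟨M₂, h₂, (hc h₂).1.mp (hle h₁') h₂'⟩
      · exact ⟨M₁, h₁, (hc h₁).1.mp h₁' (hle h₂')⟩
    · exact fun a b d => ⟨M₀, hM₀, (hc hM₀).1.syll a b d⟩
    · exact fun a => ⟨M₀, hM₀, (hc hM₀).1.clavius a⟩
    · exact fun a b => ⟨M₀, hM₀, (hc hM₀).1.explosion a b⟩
    · rintro ⟨M₁, h₁, h₁'⟩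
      exact (hc h₁).2 h₁') T ⟨h, hp⟩
  obtain ⟨hL, hpM⟩ := hM.prop
  have himp : ∀ {a}, a ∉ M → imp a p ∈ M := by
    intro a ha
    by_contra hap
    exact ha (hM.le_of_ge (y := {b | imp a b ∈ M}) ⟨hL.adjoin a, hap⟩
      (fun b hb => hL.mp (hL.weaken b a) hb) (hL.refl a))
  have hneg : ∀ a, neg a ∈ M ↔ a ∉ M := by
    intro a
    refine ⟨fun h1 h2 => hpM (hL.mp (hL.mp (hL.explosion a p) h2) h1), fun h1 => ?_⟩
    by_contra h2
    -- If both `a` and `¬a` were missing, both would imply `p`; from `¬p` one gets `¬a → a`, hence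
    -- `a`, hence `p`, and Clavius's law gives `p`.
    have h3 : imp (neg p) a ∈ M :=
      hL.trans (hL.trans (hL.mp (hL.swap _ _ _) (hL.explosion p a))
        (hL.mp (hL.syll (neg a) p a) (himp h2))) (hL.clavius a)
    exact hpM (hL.mp (hL.clavius p) (hL.trans h3 (himp h1)))
  refine ⟨M, fun a b => ⟨fun h1 h2 => hL.mp h1 h2, fun h1 => ?_⟩, hneg, hTM, hpM⟩
  by_cases ha : a ∈ M
  · exact hL.mp (hL.weaken b a) (h1 ha)
  · have h2 := (hneg a).2 ha
    exact hL.mp (hL.mp (hL.swap _ _ _) (hL.explosion a b)) h2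

end IsLukasiewicz

end RelLogic

namespace RelLogic

/-! ### Worlds of the `n`-variable formalism -/

/-- Formulas in the first `n` variables. -/
abbrev NFormula (n : ℕ) : Type := {φ : Formula // φ.UsesOnly n}

namespace NFormula

variable {n : ℕ}

def rel (x : Fin n) (A : Predicate) (y : Fin n) : NFormula n := ⟨.rel x A y, x.isLt, y.isLt⟩

def imp (φ ψ : NFormula n) : NFormula n := ⟨.imp φ ψ, φ.2, ψ.2⟩

def neg (φ : NFormula n) : NFormula n := ⟨.neg φ, φ.2⟩

def all (x : Fin n) (φ : NFormula n) : NFormula n := ⟨.all x φ, x.isLt, φ.2⟩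

def or (φ ψ : NFormula n) : NFormula n := imp (neg φ) ψ

def and (φ ψ : NFormula n) : NFormula n := neg (imp φ (neg ψ))

def iff (φ ψ : NFormula n) : NFormula n := neg (imp (imp φ ψ) (neg (imp ψ φ)))

def ex (x : Fin n) (φ : NFormula n) : NFormula n := neg (all x (neg φ))

end NFormula

theorem isLukasiewicz_thm (n : ℕ) (Ψ : Set Equation) :
    IsLukasiewicz NFormula.imp NFormula.neg {φ : NFormula n | Thm n Ψ φ} where
  mp := Thm.mp
  syll φ ψ ξ := Thm.of_postulate (.a1 φ ψ ξ) ⟨⟨φ.2, ψ.2⟩, ⟨ψ.2, ξ.2⟩, φ.2, ξ.2⟩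
  clavius φ := Thm.of_postulate (.a2 φ) ⟨⟨φ.2, φ.2⟩, φ.2⟩
  explosion φ ψ := Thm.of_postulate (.a3 φ ψ) ⟨φ.2, φ.2, ψ.2⟩

/-- Boolean valuations of the formulas in `n` variables that satisfy all provable formulas. -/
structure World (n : ℕ) (Ψ : Set Equation) where
  holds : NFormula n → Prop
  holds_imp : ∀ φ ψ, holds (φ.imp ψ) ↔ (holds φ → holds ψ)
  holds_neg : ∀ φ, holds φ.neg ↔ ¬ holds φ
  holds_of_thm : ∀ φ : NFormula n, Thm n Ψ φ → holds φ

/-- Truth in all worlds. -/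
def Holds {n : ℕ} (Ψ : Set Equation) (φ : NFormula n) : Prop := ∀ w : World n Ψ, w.holds φ

section

variable {n : ℕ} {Ψ : Set Equation}

namespace World

variable (w : World n Ψ)

theorem holds_or (φ ψ : NFormula n) : w.holds (φ.or ψ) ↔ w.holds φ ∨ w.holds ψ := by
  rw [NFormula.or, w.holds_imp, w.holds_neg]
  tauto

theorem holds_and (φ ψ : NFormula n) : w.holds (φ.and ψ) ↔ w.holds φ ∧ w.holds ψ := by
  rw [NFormula.and, w.holds_neg, w.holds_imp, w.holds_neg]
  tauto

theorem holds_iff (φ ψ : NFormula n) : w.holds (φ.iff ψ) ↔ (w.holds φ ↔ w.holds ψ) := by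
  rw [NFormula.iff, w.holds_neg, w.holds_imp, w.holds_neg, w.holds_imp, w.holds_imp]
  tauto

end World

theorem holds_iff_thm {φ : NFormula n} : Holds Ψ φ ↔ Thm n Ψ φ := by
  refine ⟨fun h => by_contra fun hφ => ?_, fun h w => w.holds_of_thm φ h⟩
  obtain ⟨v, himp, hneg, hT, hv⟩ := (isLukasiewicz_thm n Ψ).exists_valuation (p := φ) hφ
  exact hv (h ⟨fun φ => φ ∈ v, himp, hneg, fun φ hφ => hT hφ⟩)

theorem Holds.all {φ : NFormula n} (h : Holds Ψ φ) (x : Fin n) : Holds Ψ (φ.all x) :=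
  holds_iff_thm.2 ((holds_iff_thm.1 h).gen x.isLt)

namespace World

variable (w : World n Ψ)

theorem of_all {φ : NFormula n} {x : Fin n} (h : w.holds (φ.all x)) : w.holds φ :=
  (w.holds_imp _ _).1 (w.holds_of_thm ((φ.all x).imp φ)
    (Thm.of_postulate (.a6 x φ) ⟨⟨x.isLt, φ.2⟩, φ.2⟩)) h

theorem ex_of {φ : NFormula n} (x : Fin n) (h : w.holds φ) : w.holds (φ.ex x) := by
  rw [NFormula.ex, w.holds_neg]
  exact fun h' => (w.holds_neg φ).1 (w.of_all h') h

/-- Elimination of an existential quantifier. The implication is required in all worlds because only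
theorems may be generalized; facts special to `w` have to be carried inside `ψ`. -/
theorem of_ex {φ ψ : NFormula n} {x : Fin n} (h : w.holds (φ.ex x)) (hx : x.val ∉ ψ.1.fv)
    (hφψ : ∀ w : World n Ψ, w.holds φ → w.holds ψ) : w.holds ψ := by
  by_contra hψ
  rw [NFormula.ex, w.holds_neg] at h
  have h1 : Holds Ψ (ψ.neg.imp φ.neg) := fun w => by
    rw [w.holds_imp, w.holds_neg, w.holds_neg]
    exact mt (hφψ w)
  have h2 := w.holds_of_thm ((ψ.neg.imp φ.neg).all x |>.imp ((ψ.neg.all x).imp (φ.neg.all x)))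
    (Thm.of_postulate (.a5 x ψ.neg φ.neg) ⟨⟨x.isLt, ψ.2, φ.2⟩, ⟨x.isLt, ψ.2⟩, x.isLt, φ.2⟩)
  have h3 := w.holds_of_thm (ψ.neg.imp (ψ.neg.all x))
    (Thm.of_postulate (.a7 x ψ.neg hx) ⟨ψ.2, x.isLt, ψ.2⟩)
  rw [w.holds_imp] at h2 h3
  exact h ((w.holds_imp _ _).1 (h2 (h1.all x w)) (h3 ((w.holds_neg ψ).2 hψ)))

theorem leibniz {φ χ : NFormula n} {x y : Fin n} (hχ : φ.1.replace x y = χ.1)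
    (h : w.holds (.rel x .one y)) (hφ : w.holds φ) : w.holds χ := by
  have h1 := w.holds_of_thm ((NFormula.rel x .one y).imp (φ.imp χ))
    (Thm.of_postulate (by
      have := Postulate.a9 x y φ
      rwa [hχ] at this) ⟨⟨x.isLt, y.isLt⟩, φ.2, χ.2⟩)
  rw [w.holds_imp, w.holds_imp] at h1
  exact h1 h hφ

end World

/-- The rule of substitution of `y` for `x`. -/
theorem Holds.replace {φ χ : NFormula n} (h : Holds Ψ φ) {x y : Fin n} (hxy : x ≠ y)
    (hχ : φ.1.replace x y = χ.1) (hx : x.val ∉ χ.1.fv) : Holds Ψ χ := fun w => by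
  have h1 : w.holds ((NFormula.rel x .one y).ex x) := w.holds_of_thm _
    (Thm.of_postulate (.a8 x y (Fin.val_ne_of_ne hxy)) ⟨x.isLt, x.isLt, y.isLt⟩)
  exact w.of_ex h1 hx fun w h2 => w.leibniz hχ h2 (h w)

end

/-! ### The predicate operators in the four-variable formalism -/

section

variable {Ψ : Set Equation}

open NFormula

/-- A property of pairs of distinct variables that is invariant under renaming one of the two
variables holds everywhere if it holds somewhere. -/
theorem forall_ne_of_rename {Q : Fin 4 → Fin 4 → Prop} (h : Q 0 1)
    (hr : ∀ x y y', x ≠ y → x ≠ y' → y ≠ y' → Q x y → Q x y')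
    (hl : ∀ x x' y, x ≠ y → x' ≠ y → x ≠ x' → Q x y → Q x' y) :
    ∀ x y, x ≠ y → Q x y := by
  have h0 : ∀ y, 0 ≠ y → Q 0 y := by
    intro y hy
    by_cases h1 : 1 = y
    · exact h1 ▸ h
    · exact hr 0 1 y (by decide) hy h1 h
  have h1 : ∀ x y, x ≠ y → 0 ≠ y → Q x y := by
    intro x y hxy hy
    by_cases h2 : 0 = x
    · exact h2 ▸ h0 y hy
    · exact hl 0 x y hy hxy h2 (h0 y hy)
  intro x y hxy
  by_cases hy : 0 = y
  · subst hy
    obtain ⟨z, hz, hz'⟩ : ∃ z : Fin 4, x ≠ z ∧ 0 ≠ z := by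
      clear hxy
      revert x
      decide
    exact hr x z 0 hz hxy hz'.symm (h1 x z hz hz')
  · exact h1 x y hxy hy

/-- The defining axioms speak of `v_0, v_1` only; renaming one variable at a time carries an
implication to every pair of distinct variables. -/
theorem holds_imp_rel {A B : Predicate}
    (h : ∀ w : World 4 Ψ, w.holds (rel 0 A 1) → w.holds (rel 0 B 1)) :
    ∀ x y, x ≠ y → ∀ w : World 4 Ψ, w.holds (rel x A y) → w.holds (rel x B y) := by
  suffices h' : ∀ x y, x ≠ y → Holds Ψ ((rel x A y).imp (rel x B y)) from
    fun x y hxy w => (w.holds_imp _ _).1 (h' x y hxy w)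
  refine forall_ne_of_rename (fun w => (w.holds_imp _ _).2 (h w)) ?_ ?_
  · intro x y y' hxy hxy' hyy' h1
    refine h1.replace hyy' ?_ ?_
    · simp [NFormula.rel, NFormula.imp, Formula.replace, Formula.subst, Fin.val_inj, hxy]
    · simp [NFormula.rel, NFormula.imp, Formula.fv, Fin.val_inj, hxy.symm, hyy']
  · intro x x' y hxy hxy' hxx' h1
    refine h1.replace hxx' ?_ ?_
    · simp [NFormula.rel, NFormula.imp, Formula.replace, Formula.subst, Fin.val_inj, hxy.symm]
    · simp [NFormula.rel, NFormula.imp, Formula.fv, Fin.val_inj, hxy, hxx']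

theorem holds_compl (A : Predicate) :
    ∀ x y, x ≠ y → ∀ w : World 4 Ψ, w.holds (rel x (.compl A) y) ↔ ¬ w.holds (rel x A y) := by
  suffices h' : ∀ x y, x ≠ y → Holds Ψ ((rel x (.compl A) y).iff (rel x A y).neg) from
    fun x y hxy w => ((w.holds_iff _ _).1 (h' x y hxy w)).trans (w.holds_neg _)
  refine forall_ne_of_rename (holds_iff_thm.2 (Thm.of_postulate (.d2 A) (Subtype.prop _))) ?_ ?_
  · intro x y y' hxy hxy' hyy' h1
    refine h1.replace hyy' ?_ ?_
    · simp [NFormula.rel, NFormula.imp, NFormula.neg, NFormula.iff, Formula.replace,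
        Formula.subst, Fin.val_inj, hxy]
    · simp [NFormula.rel, NFormula.imp, NFormula.neg, NFormula.iff, Formula.fv, Fin.val_inj,
        hxy.symm, hyy']
  · intro x x' y hxy hxy' hxx' h1
    refine h1.replace hxx' ?_ ?_
    · simp [NFormula.rel, NFormula.imp, NFormula.neg, NFormula.iff, Formula.replace,
        Formula.subst, Fin.val_inj, hxy.symm]
    · simp [NFormula.rel, NFormula.imp, NFormula.neg, NFormula.iff, Formula.fv, Fin.val_inj,
        hxy, hxx']

theorem holds_conv (A : Predicate) :
    ∀ x y, x ≠ y → ∀ w : World 4 Ψ, w.holds (rel x (.conv A) y) ↔ w.holds (rel y A x) := by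
  suffices h' : ∀ x y, x ≠ y → Holds Ψ ((rel x (.conv A) y).iff (rel y A x)) from
    fun x y hxy w => (w.holds_iff _ _).1 (h' x y hxy w)
  refine forall_ne_of_rename (holds_iff_thm.2 (Thm.of_postulate (.d4 A) (Subtype.prop _))) ?_ ?_
  · intro x y y' hxy hxy' hyy' h1
    refine h1.replace hyy' ?_ ?_
    · simp [NFormula.rel, NFormula.imp, NFormula.neg, NFormula.iff, Formula.replace,
        Formula.subst, Fin.val_inj, hxy]
    · simp [NFormula.rel, NFormula.imp, NFormula.neg, NFormula.iff, Formula.fv, Fin.val_inj,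
        hxy.symm, hyy']
  · intro x x' y hxy hxy' hxx' h1
    refine h1.replace hxx' ?_ ?_
    · simp [NFormula.rel, NFormula.imp, NFormula.neg, NFormula.iff, Formula.replace,
        Formula.subst, Fin.val_inj, hxy.symm]
    · simp [NFormula.rel, NFormula.imp, NFormula.neg, NFormula.iff, Formula.fv, Fin.val_inj,
        hxy, hxx']

/-- `∃ z (x A z ∧ z B y)`. -/
def exComp (x z y : Fin 4) (A B : Predicate) : NFormula 4 := ((rel x A z).and (rel z B y)).ex z

theorem coe_exComp (x z y : Fin 4) (A B : Predicate) :
    (exComp x z y A B : Formula) = .ex z (.and (.rel x A z) (.rel z B y)) := rfl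

theorem subst_ex_comp {x y z : ℕ} {f : ℕ → ℕ} {A B : Predicate} (hx : x ≠ z) (hy : y ≠ z)
    (hfx : f x ≠ z) (hfy : f y ≠ z) :
    (Formula.ex z (.and (.rel x A z) (.rel z B y))).subst f =
      .ex z (.and (.rel (f x) A z) (.rel z B (f y))) := by
  simp only [Formula.ex, Formula.and, Formula.subst]
  rw [if_neg]
  · simp [hx, hy]
  · simp only [Formula.fv, Finset.mem_image, Finset.mem_erase, Finset.mem_union,
      Finset.mem_insert, Finset.mem_singleton, not_exists]
    rintro t ⟨⟨h1, (rfl | rfl) | rfl | rfl⟩, h2⟩ <;> contradiction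

theorem notMem_fv_exComp {x y z t : Fin 4} {A B : Predicate} (hx : t ≠ x) (hy : t ≠ y) :
    t.val ∉ (exComp x z y A B).1.fv := by
  simp [exComp, NFormula.rel, NFormula.imp, NFormula.neg, NFormula.and, NFormula.ex, NFormula.all,
    Formula.fv, Fin.val_inj, hx, hy]

theorem exComp_rename {x y z z' : Fin 4} {A B : Predicate} (hx : z ≠ x) (hy : z ≠ y)
    (hx' : z' ≠ x) (hy' : z' ≠ y) (w : World 4 Ψ) (h : w.holds (exComp x z y A B)) :
    w.holds (exComp x z' y A B) := by
  by_cases hz : z = z'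
  · exact hz ▸ h
  refine w.of_ex h (notMem_fv_exComp hx hy) fun w => (w.holds_imp _ _).1 ?_
  have h1 : Holds Ψ (((rel x A z').and (rel z' B y)).imp (exComp x z' y A B)) := fun w =>
    (w.holds_imp _ _).2 (w.ex_of z')
  revert w
  refine h1.replace (Ne.symm hz) ?_ ?_
  · simp only [NFormula.rel, NFormula.imp, NFormula.neg, NFormula.and, coe_exComp,
      Formula.replace, Formula.subst]
    rw [subst_ex_comp] <;> simp [Fin.val_inj, hx'.symm, hy'.symm]
  · simp [exComp, NFormula.rel, NFormula.imp, NFormula.neg, NFormula.and, NFormula.ex,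
      NFormula.all, Formula.fv, Fin.val_inj, hx', hy', Ne.symm hz]

theorem holds_comp (A B : Predicate) {x y z : Fin 4} (hxy : x ≠ y) (hx : z ≠ x) (hy : z ≠ y)
    (w : World 4 Ψ) :
    w.holds (rel x (.comp A B) y) ↔ w.holds (exComp x z y A B) := by
  suffices h' : ∀ x y, x ≠ y → ∃ z, z ≠ x ∧ z ≠ y ∧
      Holds Ψ ((rel x (.comp A B) y).iff (exComp x z y A B)) by
    obtain ⟨t, htx, hty, ht⟩ := h' x y hxy
    rw [(w.holds_iff _ _).1 (ht w)]
    exact ⟨exComp_rename htx hty hx hy w, exComp_rename hx hy htx hty w⟩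
  -- Before an endpoint is renamed, the bound variable is moved away from the old and the new
  -- endpoints, so that no capture occurs.
  have fourth : ∀ x y t : Fin 4, ∃ z, z ≠ x ∧ z ≠ y ∧ z ≠ t := by decide
  refine forall_ne_of_rename ⟨2, by decide, by decide,
    holds_iff_thm.2 (Thm.of_postulate (.d3 A B) (Subtype.prop _))⟩ ?_ ?_
  · rintro x y y' hxy hxy' hyy' ⟨z, hx, hy, h1⟩
    obtain ⟨t, htx, hty, hty'⟩ := fourth x y y'
    have h2 : Holds Ψ ((rel x (.comp A B) y).iff (exComp x t y A B)) := fun w => by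
      rw [w.holds_iff, (w.holds_iff _ _).1 (h1 w)]
      exact ⟨exComp_rename hx hy htx hty w, exComp_rename htx hty hx hy w⟩
    refine ⟨t, htx, hty', h2.replace hyy' ?_ ?_⟩
    · simp only [NFormula.rel, NFormula.imp, NFormula.neg, NFormula.iff, coe_exComp,
        Formula.replace, Formula.subst]
      rw [subst_ex_comp] <;> simp [Fin.val_inj, hxy, htx.symm, hty.symm, hty'.symm]
    · simp [exComp, NFormula.rel, NFormula.imp, NFormula.neg, NFormula.and, NFormula.ex,
        NFormula.all, NFormula.iff, Formula.fv, Fin.val_inj, hxy.symm, hyy']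
  · rintro x x' y hxy hxy' hxx' ⟨z, hx, hy, h1⟩
    obtain ⟨t, htx, htx', hty⟩ := fourth x x' y
    have h2 : Holds Ψ ((rel x (.comp A B) y).iff (exComp x t y A B)) := fun w => by
      rw [w.holds_iff, (w.holds_iff _ _).1 (h1 w)]
      exact ⟨exComp_rename hx hy htx hty w, exComp_rename htx hty hx hy w⟩
    refine ⟨t, htx', hty, h2.replace hxx' ?_ ?_⟩
    · simp only [NFormula.rel, NFormula.imp, NFormula.neg, NFormula.iff, coe_exComp,
        Formula.replace, Formula.subst]
      rw [subst_ex_comp] <;> simp [Fin.val_inj, hxy.symm, htx.symm, htx'.symm, hty.symm]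
    · simp [exComp, NFormula.rel, NFormula.imp, NFormula.neg, NFormula.and, NFormula.ex,
        NFormula.all, NFormula.iff, Formula.fv, Fin.val_inj, hxy, hxx']

theorem proves_iff_holds {φ : NFormula 4} (hφ : φ.1.fv = ∅) : Proves 4 Ψ φ.1 ↔ Holds Ψ φ := by
  rw [holds_iff_thm]
  refine ⟨fun h => Thm.of_closure ?_, fun h => ?_⟩
  · rwa [Formula.closure_of_fv_eq_empty hφ]
  · have := Thm.closure h
    rwa [Formula.closure_of_fv_eq_empty hφ] at this

theorem holds_closure_iff {φ : NFormula 4} :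
    Holds Ψ ⟨φ.1.closure, Formula.usesOnly_closure.2 φ.2⟩ ↔ Holds Ψ φ := by
  rw [← proves_iff_holds (Formula.fv_closure _), holds_iff_thm]
  exact ⟨Thm.of_closure, Thm.closure⟩

theorem eqn_iff_holds {A B : Predicate} :
    Proves 4 Ψ (.eqn A B) ↔ Holds Ψ ((rel (0 : Fin 4) A 1).iff (rel 0 B 1)) := by
  let χ : NFormula 4 := (rel 0 A 1).iff (rel 0 B 1)
  let ε : NFormula 4 := ⟨.eqn A B, trivial⟩
  let κ : NFormula 4 := ⟨χ.1.closure, Formula.usesOnly_closure.2 χ.2⟩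
  have hd : Holds Ψ (ε.iff κ) := by
    refine (proves_iff_holds ?_).1 (.post _ (.d5 A B) (ε.iff κ).2)
    simp [NFormula.iff, NFormula.imp, NFormula.neg, Formula.fv, ε, κ, Formula.fv_closure]
  refine (proves_iff_holds (φ := ε) rfl).trans (Iff.trans ?_ holds_closure_iff)
  exact forall_congr' fun w => (w.holds_iff _ _).1 (hd w)

/-! ### The algebra of predicates in the four-variable formalism -/

/-- `x A y` implies `x B y`, provably from `Ψ` with four variables. -/
def Below (Ψ : Set Equation) (A B : Predicate) : Prop :=
  ∀ x y : Fin 4, x ≠ y → ∀ w : World 4 Ψ, w.holds (rel x A y) → w.holds (rel x B y)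

theorem holds_add (A B : Predicate) (w : World 4 Ψ) :
    w.holds (rel 0 (.add A B) 1) ↔ w.holds (rel 0 A 1) ∨ w.holds (rel 0 B 1) := by
  rw [← w.holds_or]
  exact (w.holds_iff _ _).1 (w.holds_of_thm
    ((rel 0 (.add A B) 1).iff ((rel 0 A 1).or (rel 0 B 1)))
    (Thm.of_postulate (.d1 A B) (Subtype.prop _)))

theorem proves_incl_iff {A B : Predicate} :
    Proves 4 Ψ (.eqn (incl A B).1 (incl A B).2) ↔ Below Ψ A B := by
  rw [eqn_iff_holds]
  constructor
  · refine fun h => holds_imp_rel fun w hA => ?_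
    exact ((w.holds_iff _ _).1 (h w)).1 ((holds_add A B w).2 (Or.inl hA))
  · intro h w
    rw [w.holds_iff, incl, holds_add]
    exact ⟨fun h' => h'.elim (h 0 1 (by decide) w) id, Or.inr⟩

theorem Below.refl (A : Predicate) : Below Ψ A A := fun _ _ _ _ h => h

theorem Below.trans {A B C : Predicate} (h₁ : Below Ψ A B) (h₂ : Below Ψ B C) : Below Ψ A C :=
  fun x y hxy w h => h₂ x y hxy w (h₁ x y hxy w h)

theorem comp_of {A B : Predicate} {x y z : Fin 4} (hxy : x ≠ y) (hx : z ≠ x) (hy : z ≠ y)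
    (w : World 4 Ψ) (hA : w.holds (rel x A z)) (hB : w.holds (rel z B y)) :
    w.holds (rel x (.comp A B) y) :=
  (holds_comp A B hxy hx hy w).2 (w.ex_of z ((w.holds_and _ _).2 ⟨hA, hB⟩))

theorem of_comp {A B : Predicate} {φ : NFormula 4} {x y : Fin 4} (z : Fin 4) (hxy : x ≠ y)
    (hx : z ≠ x) (hy : z ≠ y) (hφ : z.val ∉ φ.1.fv) (w : World 4 Ψ)
    (h : w.holds (rel x (.comp A B) y))
    (himp : ∀ w : World 4 Ψ, w.holds (rel x A z) → w.holds (rel z B y) → w.holds φ) :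
    w.holds φ :=
  w.of_ex ((holds_comp A B hxy hx hy w).1 h) hφ fun w h =>
    himp w ((w.holds_and _ _).1 h).1 ((w.holds_and _ _).1 h).2

theorem notMem_fv_rel {x y z : Fin 4} {A : Predicate} (hx : z ≠ x) (hy : z ≠ y) :
    z.val ∉ (rel x A y).1.fv := by
  simp [NFormula.rel, Formula.fv, Fin.val_inj, hx, hy]

/-- Residuation: a failure of `X → Z` at a pair is a point related by `X` to its source and not by
`Z` to its target, which `Y` at the pair would contradict. -/
theorem below_imp_of_comp {X Y Z : Predicate} (h : Below Ψ (.comp X Y) Z) :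
    Below Ψ Y (.imp X Z) := by
  refine holds_imp_rel fun w hY => ?_
  by_contra hc
  rw [Predicate.imp, holds_compl _ _ _ (by decide), not_not] at hc
  suffices h' : w.holds (rel 0 Y 1).neg from (w.holds_neg _).1 h' hY
  refine of_comp (φ := (rel 0 Y 1).neg) 2 (by decide) (by decide) (by decide)
    (notMem_fv_rel (x := 0) (y := 1) (A := Y) (by decide) (by decide)) w hc fun w h1 h2 => ?_
  rw [holds_conv _ _ _ (by decide)] at h1
  rw [holds_compl _ _ _ (by decide)] at h2
  rw [w.holds_neg]
  exact fun h3 => h2 (h 2 1 (by decide) w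
    (comp_of (by decide) (by decide) (by decide) w h1 h3))

theorem comp_below_of_below_imp {X Y Z : Predicate} (h : Below Ψ Y (.imp X Z)) :
    Below Ψ (.comp X Y) Z := by
  refine holds_imp_rel fun w hXY => ?_
  refine of_comp 2 (by decide) (by decide) (by decide)
    (notMem_fv_rel (by decide) (by decide)) w hXY fun w h1 h2 => ?_
  by_contra hZ
  have h3 := h 2 1 (by decide) w h2
  rw [Predicate.imp, holds_compl _ _ _ (by decide)] at h3
  exact h3 (comp_of (z := 0) (by decide) (by decide) (by decide) w
    ((holds_conv _ _ _ (by decide) w).2 h1) ((holds_compl _ _ _ (by decide) w).2 hZ))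

/-- Two endpoints and two intermediate points must be named at once; this is where four variables
are needed. -/
theorem comp_assoc_below (A B C : Predicate) :
    Below Ψ (.comp A (.comp B C)) (.comp (.comp A B) C) := by
  refine holds_imp_rel fun w h => ?_
  refine of_comp 2 (by decide) (by decide) (by decide)
    (notMem_fv_rel (by decide) (by decide)) w h fun w h1 h2 => ?_
  -- The elimination passes to another world, so the fact `0 A 2` travels as the antecedent of the
  -- goal.
  refine (w.holds_imp _ _).1 (of_comp (φ := (rel 0 A 2).imp _) 3 (by decide) (by decide)
    (by decide) ?_ w h2 fun w h3 h4 => (w.holds_imp _ _).2 fun h1 => ?_) h1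
  · simp [NFormula.rel, NFormula.imp, Formula.fv]
  · exact comp_of (z := 3) (by decide) (by decide) (by decide) w
      (comp_of (by decide) (by decide) (by decide) w h1 h3) h4

theorem comp_assoc_above (A B C : Predicate) :
    Below Ψ (.comp (.comp A B) C) (.comp A (.comp B C)) := by
  refine holds_imp_rel fun w h => ?_
  refine of_comp 2 (by decide) (by decide) (by decide)
    (notMem_fv_rel (by decide) (by decide)) w h fun w h1 h2 => ?_
  refine (w.holds_imp _ _).1 (of_comp (φ := (rel 2 C 1).imp _) 3 (by decide) (by decide)
    (by decide) ?_ w h1 fun w h3 h4 => (w.holds_imp _ _).2 fun h2 => ?_) h2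
  · simp [NFormula.rel, NFormula.imp, Formula.fv]
  · exact comp_of (z := 3) (by decide) (by decide) (by decide) w h3
      (comp_of (by decide) (by decide) (by decide) w h4 h2)

theorem comp_one_below (A : Predicate) : Below Ψ (.comp A .one) A := by
  refine holds_imp_rel fun w h => ?_
  refine of_comp 2 (by decide) (by decide) (by decide)
    (notMem_fv_rel (by decide) (by decide)) w h fun w h1 h2 => ?_
  exact w.leibniz rfl h2 h1

theorem inf_below_left (A B : Predicate) : Below Ψ (.inf A B) A := by
  refine holds_imp_rel fun w h => ?_
  rw [Predicate.inf, holds_compl _ _ _ (by decide), holds_add, holds_compl _ _ _ (by decide)] at h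
  tauto

theorem inf_below_right (A B : Predicate) : Below Ψ (.inf A B) B := by
  refine holds_imp_rel fun w h => ?_
  rw [Predicate.inf, holds_compl _ _ _ (by decide), holds_add, holds_compl _ _ _ (by decide),
    holds_compl _ _ _ (by decide)] at h
  tauto

theorem proves_one_incl_imp {X Y : Predicate} (h : Below Ψ X Y) :
    Proves 4 Ψ (.eqn (incl .one (.imp X Y)).1 (incl .one (.imp X Y)).2) :=
  proves_incl_iff.2 (below_imp_of_comp ((comp_one_below X).trans h))

end

/-! ### The schemes in `TR` -/

section

local notation "Φ" => densityEqs ∪ commEqs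

open Predicate

theorem below_comp_self (A : Predicate) : Below Φ A (comp A A) :=
  proves_incl_iff.1 (.hyp _ (Or.inl ⟨A, rfl⟩))

theorem comp_comm_below (A B : Predicate) : Below Φ (comp A B) (comp B A) := by
  have h := eqn_iff_holds.1 (Proves.hyp (n := 4) (Ψ := Φ) _ (Or.inr ⟨A, B, rfl⟩))
  exact holds_imp_rel fun w => ((w.holds_iff _ _).1 (h w)).1

theorem comp_mono_right {A B C : Predicate} (h : Below Φ B C) : Below Φ (comp A B) (comp A C) :=
  comp_below_of_below_imp (h.trans (below_imp_of_comp (.refl _)))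

theorem comp_mono_left {A B C : Predicate} (h : Below Φ A B) : Below Φ (comp A C) (comp B C) :=
  (comp_comm_below A C).trans ((comp_mono_right h).trans (comp_comm_below C B))

theorem comp_mono {A B C D : Predicate} (h : Below Φ A B) (h' : Below Φ C D) :
    Below Φ (comp A C) (comp B D) := (comp_mono_left h).trans (comp_mono_right h')

theorem comp_imp_below (A B : Predicate) : Below Φ (comp A (imp A B)) B :=
  comp_below_of_below_imp (.refl _)

theorem comp_left_comm_below (A B C : Predicate) :
    Below Φ (comp A (comp B C)) (comp B (comp A C)) :=
  (comp_assoc_below A B C).trans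
    ((comp_mono_left (comp_comm_below A B)).trans (comp_assoc_above B A C))

/-- Modus ponens twice; the inner factor `A` is consumed first. -/
theorem comp_comp_imp_imp_below (A B C : Predicate) :
    Below Φ (comp (comp B A) (imp A (imp B C))) C :=
  (comp_assoc_above B A _).trans
    ((comp_mono_right (comp_imp_below A _)).trans (comp_imp_below B C))

/-- The outer implication becomes an inclusion and residuation moves the remaining antecedents to
the left. Fusion reverses the order of `;`, which explains the directions of associativity; density
duplicates an antecedent in the contraction-like schemes. -/
theorem Scheme.inst_mem_TR (s : Scheme) (A B C : Predicate) : s.inst A B C ∈ TR := by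
  cases s <;> refine proves_one_incl_imp ?_
  case prefixing =>
    refine below_imp_of_comp (below_imp_of_comp ?_)
    exact (comp_assoc_below _ _ _).trans
      ((comp_mono_left (comp_imp_below C A)).trans (comp_imp_below A B))
  case imp_to_fus => exact below_imp_of_comp (comp_comp_imp_imp_below A B C)
  case fus_to_imp =>
    refine below_imp_of_comp (below_imp_of_comp ?_)
    exact (comp_assoc_below _ _ _).trans (comp_imp_below _ _)
  case fus_mono =>
    refine below_imp_of_comp ?_
    exact (comp_assoc_above _ _ _).trans (comp_mono_right (comp_imp_below A B))
  case fus_assoc => exact comp_assoc_below _ _ _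
  case fus_assoc_rev => exact comp_assoc_above _ _ _
  case permutation =>
    refine below_imp_of_comp (below_imp_of_comp ?_)
    exact (comp_left_comm_below _ _ _).trans
      ((comp_assoc_below _ _ _).trans (comp_comp_imp_imp_below A B C))
  case suffixing =>
    refine below_imp_of_comp (below_imp_of_comp ?_)
    exact (comp_left_comm_below _ _ _).trans ((comp_mono_right (comp_imp_below A B)).trans
      ((comp_comm_below _ _).trans (comp_imp_below B C)))
  case contraction =>
    refine below_imp_of_comp ?_
    exact (comp_mono_left (below_comp_self A)).trans (comp_comp_imp_imp_below A A B)
  case contraction_and =>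
    refine below_imp_of_comp ?_
    exact (comp_mono_left ((below_comp_self _).trans
      (comp_mono (inf_below_right A B) (inf_below_left A B)))).trans
      (comp_comp_imp_imp_below A B C)
  case self_distribution =>
    refine below_imp_of_comp (below_imp_of_comp ?_)
    refine (comp_mono_left (below_comp_self A)).trans ?_
    refine (comp_assoc_above _ _ _).trans ?_
    refine (comp_mono_right ((comp_assoc_below _ _ _).trans
      (comp_mono_left (comp_imp_below A B)))).trans ?_
    exact (comp_left_comm_below _ _ _).trans
      ((comp_assoc_below _ _ _).trans (comp_comp_imp_imp_below A B C))

end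

end RelLogic

theorem theorem12 :
    (∀ (s : RelLogic.Scheme) (A B C : RelLogic.Predicate),
      A ∈ RelLogic.relevancePreds → B ∈ RelLogic.relevancePreds →
        C ∈ RelLogic.relevancePreds → s.inst A B C ∈ RelLogic.logicR) ∧
    (∀ (s : RelLogic.Scheme) (A B C : RelLogic.Predicate), s.inst A B C ∈ RelLogic.TR) ∧
    (∀ (s : RelLogic.Scheme) (i j k : ℕ), i ≠ j → i ≠ k → j ≠ k →
      s.inst (.var i) (.var j) (.var k) ∉ RelLogic.CT 3 ∅ ∧
      ¬ RelLogic.NProvable 3 (RelLogic.densityEqs ∪ RelLogic.symmEqs)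
          (s.inst (.var i) (.var j) (.var k)) ∧
      ¬ RelLogic.K₁.Valid (s.inst (.var i) (.var j) (.var k))) ∧
    RelLogic.K₁.Cm.IsSemiassociative ∧ RelLogic.K₁.Cm.Dense ∧ RelLogic.K₁.Cm.Symmetric ∧
      ¬ RelLogic.K₁.Cm.Associative := by
  exact ⟨fun s _ _ _ hA hB hC => s.inst_mem_logicR hA hB hC,
    fun s A B C => s.inst_mem_TR A B C,
    fun s i j k hij hik hjk =>
      have hs := RelLogic.K₁_not_valid s i j k hij hik hjk
      ⟨mt RelLogic.valid_of_mem_CT_three hs, mt RelLogic.valid_of_nProvable_three hs, hs⟩,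
    RelLogic.K₁_isSemiassociative, RelLogic.K₁_dense, RelLogic.K₁_conv,
    RelLogic.K₁_not_associative⟩
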